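/- Theorem (Serre's finiteness theorem). Let $k$ be a commutative ring (for instance an algebraically closed field) and let $R=\bigoplus_{n\ge 0}R_n$ be a right Noetherian $\mathbb N$-graded $k$-algebra. Let $\mathrm{Gr}(R)$ be the category of $\mathbb Z$-graded right $R$-modules with degree $0$ morphisms, and for $M\in\mathrm{Gr}(R)$ and $d\in\mathbb Z$ let $M[d]$ be the shifted module, $M[d]_i=M_{i+d}$. Let $\mathrm{Tor}(R)\subset\mathrm{Gr}(R)$ be the thick subcategory of torsion modules (those $M$ such that for every $x\in M$ there is an $s$ with $xR_{\ge s}=0$), let $\mathrm{QGr}(R)=\mathrm{Gr}(R)/\mathrm{Tor}(R)$ be the quotient category, with quotient functor $\pi$, let $\mathcal R=\pi R$, and let $\mathrm{qgr}(R)$ be the full subcategory of Noetherian objects of $\mathrm{QGr}(R)$. The functors $M\mapsto M[d]$ induce autoequivalences $\mathscr F\mapsto\mathscr F[d]$ of $\mathrm{QGr}(R)$. For $\mathscr F\in\mathrm{QGr}(R)$ and $j\ge 0$ put $H^j(\mathscr F)=\mathrm{Ext}^j_{\mathrm{QGr}(R)}(\mathcal R,\mathscr F)$; it is a right $R_0$-module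 through the action of $R_0$ on $\mathcal R$ by left multiplication. Assume that $R$ satisfies $\chi$: for every finitely generated graded right $R$-module $M$ and every $j\ge 0$, the graded Ext group $$\underline{\mathrm{Ext}}^j_R(R/R_{\ge 1},M)=\bigoplus_{d\in\mathbb Z}\mathrm{Ext}^j_{\mathrm{Gr}(R)}(R/R_{\ge 1},M[d])$$ is finitely generated as a right $R_0$-module, the action being induced by left multiplication on $R/R_{\ge 1}$ (equivalently, it is finitely generated as a right $R$-module, because $R_{\ge 1}$ acts on it by zero). Then for every $\mathscr F\in\mathrm{qgr}(R)$: 1. for every $j\ge 0$, $H^j(\mathscr F)$ is a finitely generated right $R_0$-module; 2. for every $j\ge 1$, there is $d_0\in\mathbb Z$ such that $H^j(\mathscr F[d])=0$ for all $d\ge d_0$. -/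

import Mathlib

open CategoryTheory CategoryTheory.Limits CategoryTheory.Abelian DirectSum

universe w u

namespace NCProj

/-! ### Graded right modules

`R` is an `ℕ`-graded algebra over a commutative ring `k`, with degree `n` component `𝒜 n`. -/

/-- A `ℤ`-graded right `R`-module: a family of abelian groups `M.deg i`, `i : ℤ`, with biadditive
associative and unital multiplication maps `M_i × R_n → M_{i+n}`; `M.act n h x a` is the product
`x · a`, where `h : i + n = j` identifies the degree of the result. -/
structure GrMod {k : Type w} {R : Type u} [CommRing k] [Ring R] [Algebra k R]
    (𝒜 : ℕ → Submodule k R) [GradedAlgebra 𝒜] where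
  deg : ℤ → Type u
  [grp : ∀ i, AddCommGroup (deg i)]
  act : ∀ {i j : ℤ} (n : ℕ), i + n = j → deg i →+ 𝒜 n →+ deg j
  act_one : ∀ {i : ℤ} (x : deg i),
    act 0 (by simp) x ⟨1, SetLike.GradedOne.one_mem⟩ = x
  act_mul : ∀ {i j l : ℤ} (m n : ℕ) (h : i + m = j) (h' : j + n = l) (x : deg i)
    (a : 𝒜 m) (b : 𝒜 n),
    act n h' (act m h x a) b =
      act (m + n) (by push_cast; omega) x ⟨a * b, SetLike.GradedMul.mul_mem a.2 b.2⟩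

attribute [instance] GrMod.grp

section

variable {k : Type w} {R : Type u} [CommRing k] [Ring R] [Algebra k R]
  {𝒜 : ℕ → Submodule k R} [GradedAlgebra 𝒜]

namespace GrMod

/-- Morphisms of graded right modules: right `R`-linear maps of degree `0`. -/
@[ext]
structure Hom (M N : GrMod 𝒜) where
  app : ∀ i, M.deg i →+ N.deg i
  app_act : ∀ {i j : ℤ} (n : ℕ) (h : i + n = j) (x : M.deg i) (a : 𝒜 n),
    app j (M.act n h x a) = N.act n h (app i x) a

/-- The category `Gr(R)` of `ℤ`-graded right `R`-modules. -/
instance : Category (GrMod 𝒜) where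
  Hom := Hom
  id M := { app := fun _ => AddMonoidHom.id _, app_act := fun _ _ _ _ => rfl }
  comp f g :=
    { app := fun i => (g.app i).comp (f.app i)
      app_act := fun n h x a => by simp [f.app_act, g.app_act] }

@[ext]
theorem hom_ext {M N : GrMod 𝒜} {f g : M ⟶ N} (h : ∀ i x, f.app i x = g.app i x) : f = g :=
  Hom.ext (funext fun i => AddMonoidHom.ext (h i))

@[simp] theorem id_app (M : GrMod 𝒜) (i : ℤ) (x : M.deg i) : Hom.app (𝟙 M) i x = x := rfl

@[simp] theorem comp_app {M N P : GrMod 𝒜} (f : M ⟶ N) (g : N ⟶ P) (i : ℤ) (x : M.deg i) :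
    (f ≫ g).app i x = g.app i (f.app i x) := rfl

instance (M N : GrMod 𝒜) : Zero (M ⟶ N) where
  zero := { app := fun _ => 0, app_act := by simp }

instance (M N : GrMod 𝒜) : Add (M ⟶ N) where
  add f g :=
    { app := fun i => f.app i + g.app i
      app_act := fun n h x a => by simp [f.app_act, g.app_act] }

instance (M N : GrMod 𝒜) : Neg (M ⟶ N) where
  neg f :=
    { app := fun i => - f.app i
      app_act := fun n h x a => by simp [f.app_act] }

@[simp] theorem zero_app {M N : GrMod 𝒜} (i : ℤ) (x : M.deg i) :
    Hom.app (0 : M ⟶ N) i x = 0 := rfl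

@[simp] theorem add_app {M N : GrMod 𝒜} (f g : M ⟶ N) (i : ℤ) (x : M.deg i) :
    (f + g).app i x = f.app i x + g.app i x := rfl

@[simp] theorem neg_app {M N : GrMod 𝒜} (f : M ⟶ N) (i : ℤ) (x : M.deg i) :
    (-f).app i x = - f.app i x := rfl

instance (M N : GrMod 𝒜) : AddCommGroup (M ⟶ N) where
  add_assoc f g h := by ext; simp [add_assoc]
  zero_add f := by ext; simp
  add_zero f := by ext; simp
  nsmul := nsmulRec
  zsmul := zsmulRec
  neg_add_cancel f := by ext; simp
  add_comm f g := by ext; simp [add_comm]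

instance : Preadditive (GrMod 𝒜) where
  add_comp _ _ _ f f' g := by ext; simp
  comp_add _ _ _ f g g' := by ext; simp

/-! ### `Gr(R)` is abelian -/

/-- The degreewise kernel. -/
def ker {M N : GrMod 𝒜} (f : M ⟶ N) : GrMod 𝒜 where
  deg i := (f.app i).ker
  act {i j} n h := AddMonoidHom.mk' (fun x => AddMonoidHom.mk'
      (fun a => ⟨M.act n h x.1 a, by
        rw [AddMonoidHom.mem_ker, f.app_act, (AddMonoidHom.mem_ker).1 x.2]; simp⟩)
      (fun a b => by ext; simp)) (fun x y => by ext; simp)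
  act_one x := by ext; simp [M.act_one]
  act_mul m n h h' x a b := by ext; simp [M.act_mul]

/-- The inclusion of the kernel. -/
def kerι {M N : GrMod 𝒜} (f : M ⟶ N) : ker f ⟶ M where
  app i := (f.app i).ker.subtype
  app_act _ _ _ _ := rfl

theorem kerι_comp {M N : GrMod 𝒜} (f : M ⟶ N) : kerι f ≫ f = 0 := by
  ext i x
  exact x.2

/-- Factorization of a morphism through the kernel. -/
def kerLift {M N P : GrMod 𝒜} (f : M ⟶ N) (g : P ⟶ M) (hg : g ≫ f = 0) : P ⟶ ker f where
  app i := (g.app i).codRestrict (f.app i).ker (fun x => by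
    rw [AddMonoidHom.mem_ker, ← comp_app, hg, zero_app])
  app_act n h x a := Subtype.ext (g.app_act n h x a)

/-- The degreewise cokernel. -/
def coker {M N : GrMod 𝒜} (f : M ⟶ N) : GrMod 𝒜 where
  deg i := N.deg i ⧸ (f.app i).range
  act {i j} n h := QuotientAddGroup.lift _
    (AddMonoidHom.mk' (fun x => (QuotientAddGroup.mk' (f.app j).range).comp (N.act n h x))
      (fun x y => by ext; simp)) (by
        rintro _ ⟨x, rfl⟩
        ext a
        exact (QuotientAddGroup.eq_zero_iff _).2 ⟨M.act n h x a, f.app_act n h x a⟩)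
  act_one x := by
    obtain ⟨x, rfl⟩ := QuotientAddGroup.mk_surjective x
    exact congrArg _ (N.act_one x)
  act_mul m n h h' x a b := by
    obtain ⟨x, rfl⟩ := QuotientAddGroup.mk_surjective x
    exact congrArg _ (N.act_mul m n h h' x a b)

/-- The projection to the cokernel. -/
def cokerπ {M N : GrMod 𝒜} (f : M ⟶ N) : N ⟶ coker f where
  app i := QuotientAddGroup.mk' (f.app i).range
  app_act _ _ _ _ := rfl

theorem comp_cokerπ {M N : GrMod 𝒜} (f : M ⟶ N) : f ≫ cokerπ f = 0 := by
  ext i x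
  exact (QuotientAddGroup.eq_zero_iff _).2 ⟨x, rfl⟩

/-- Factorization of a morphism through the cokernel. -/
def cokerDesc {M N P : GrMod 𝒜} (f : M ⟶ N) (g : N ⟶ P) (hg : f ≫ g = 0) : coker f ⟶ P where
  app i := QuotientAddGroup.lift _ (g.app i) (by
    rintro _ ⟨x, rfl⟩
    exact congrArg (fun l : M ⟶ P => l.app i x) hg)
  app_act n h x a := by
    obtain ⟨x, rfl⟩ := QuotientAddGroup.mk_surjective x
    exact g.app_act n h x a

/-- The kernel fork is limiting. -/
def isLimitKer {M N : GrMod 𝒜} (f : M ⟶ N) : IsLimit (KernelFork.ofι (kerι f) (kerι_comp f)) :=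
  KernelFork.IsLimit.ofι _ _ (fun g hg => kerLift f g hg) (fun _ _ => rfl) (by
    rintro P _ hg m rfl
    rfl)

/-- The cokernel cofork is colimiting. -/
def isColimitCoker {M N : GrMod 𝒜} (f : M ⟶ N) :
    IsColimit (CokernelCofork.ofπ (cokerπ f) (comp_cokerπ f)) :=
  CokernelCofork.IsColimit.ofπ _ _ (fun g hg => cokerDesc f g hg) (fun _ _ => rfl) (by
    rintro P _ hg m rfl
    ext i x
    obtain ⟨x, rfl⟩ := QuotientAddGroup.mk_surjective x
    rfl)

theorem injective_of_mono {M N : GrMod 𝒜} (f : M ⟶ N) [Mono f] (i : ℤ) :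
    Function.Injective (f.app i) := by
  rw [injective_iff_map_eq_zero]
  intro x hx
  have h : kerι f = 0 := by rw [← cancel_mono f, kerι_comp, zero_comp]
  exact congrArg (fun g : ker f ⟶ M => g.app i ⟨x, hx⟩) h

theorem surjective_of_epi {M N : GrMod 𝒜} (f : M ⟶ N) [Epi f] (i : ℤ) :
    Function.Surjective (f.app i) := by
  intro x
  have h : cokerπ f = 0 := by rw [← cancel_epi f, comp_cokerπ, comp_zero]
  exact (QuotientAddGroup.eq_zero_iff _).1 (congrArg (fun g : N ⟶ coker f => g.app i x) h)

/-- The zero graded module. -/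
def zeroObj : GrMod 𝒜 where
  deg _ := PUnit
  act _ _ := 0
  act_one _ := rfl
  act_mul _ _ _ _ _ _ _ := rfl

theorem isZero_zeroObj : IsZero (zeroObj : GrMod 𝒜) := by
  rw [IsZero.iff_id_eq_zero]
  rfl

/-- The product of two graded modules. -/
def prod (M N : GrMod 𝒜) : GrMod 𝒜 where
  deg i := M.deg i × N.deg i
  act n h := AddMonoidHom.mk' (fun x => (M.act n h x.1).prod (N.act n h x.2))
    (fun x y => by ext <;> simp)
  act_one x := Prod.ext (M.act_one x.1) (N.act_one x.2)
  act_mul m n h h' x a b :=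
    Prod.ext (M.act_mul m n h h' x.1 a b) (N.act_mul m n h h' x.2 a b)

/-- The first projection of a product. -/
def prodFst (M N : GrMod 𝒜) : prod M N ⟶ M where
  app _ := AddMonoidHom.fst _ _
  app_act _ _ _ _ := rfl

/-- The second projection of a product. -/
def prodSnd (M N : GrMod 𝒜) : prod M N ⟶ N where
  app _ := AddMonoidHom.snd _ _
  app_act _ _ _ _ := rfl

/-- The product of two graded modules is a product in `Gr(R)`. -/
def isLimitProd (M N : GrMod 𝒜) : IsLimit (BinaryFan.mk (prodFst M N) (prodSnd M N)) :=
  BinaryFan.isLimitMk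
    (fun s =>
      { app := fun i => (Hom.app s.fst i).prod (Hom.app s.snd i)
        app_act := fun n h x a =>
          Prod.ext (Hom.app_act s.fst n h x a) (Hom.app_act s.snd n h x a) })
    (fun _ => rfl) (fun _ => rfl) (fun s m h₁ h₂ => by
      ext i x
      exact Prod.ext (congrArg (fun g => Hom.app g i x) h₁) (congrArg (fun g => Hom.app g i x) h₂))

instance : HasZeroObject (GrMod 𝒜) := ⟨zeroObj, isZero_zeroObj⟩

instance : HasFiniteProducts (GrMod 𝒜) :=
  have : HasBinaryProducts (GrMod 𝒜) :=
    have (M N : GrMod 𝒜) : HasLimit (pair M N) := ⟨⟨⟨_, isLimitProd M N⟩⟩⟩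
    hasBinaryProducts_of_hasLimit_pair _
  hasFiniteProducts_of_has_binary_and_terminal

instance : HasKernels (GrMod 𝒜) where
  has_limit f := ⟨⟨⟨_, isLimitKer f⟩⟩⟩

instance : HasCokernels (GrMod 𝒜) where
  has_colimit f := ⟨⟨⟨_, isColimitCoker f⟩⟩⟩

/-- A monomorphism is a kernel of the projection to its cokernel. -/
@[reducible]
noncomputable def normalMono {M N : GrMod 𝒜} (f : M ⟶ N) [Mono f] : NormalMono f where
  Z := coker f
  g := cokerπ f
  w := comp_cokerπ f
  isLimit := KernelFork.IsLimit.ofι' _ _ (fun {P} g hg => by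
    have hr : ∀ i x, ∃ y, f.app i y = g.app i x := fun i x =>
      (QuotientAddGroup.eq_zero_iff _).1 (congrArg (fun l : P ⟶ coker f => l.app i x) hg)
    choose l hl using hr
    exact ⟨{ app := fun i => AddMonoidHom.mk' (l i) (fun x y =>
                injective_of_mono f i (by simp [hl]))
             app_act := fun n h x a => injective_of_mono f _ (by
                simp [hl, f.app_act, g.app_act]) }, by ext i x; exact hl i x⟩)

/-- An epimorphism is a cokernel of the inclusion of its kernel. -/
@[reducible]
noncomputable def normalEpi {M N : GrMod 𝒜} (f : M ⟶ N) [Epi f] : NormalEpi f where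
  W := ker f
  g := kerι f
  w := kerι_comp f
  isColimit := CokernelCofork.IsColimit.ofπ' _ _ (fun {P} g hg => by
    have hk : ∀ i x y, f.app i x = f.app i y → g.app i x = g.app i y := fun i x y hxy => by
      have : x - y ∈ (f.app i).ker := by simp [AddMonoidHom.mem_ker, hxy]
      have h2 : g.app i (x - y) = 0 :=
        congrArg (fun l : ker f ⟶ P => l.app i ⟨x - y, this⟩) hg
      rwa [map_sub, sub_eq_zero] at h2
    let s : ∀ i, N.deg i → M.deg i := fun i => Function.surjInv (surjective_of_epi f i)
    have hs : ∀ i x, f.app i (s i x) = x := fun i => Function.surjInv_eq (surjective_of_epi f i)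
    exact ⟨{ app := fun i => AddMonoidHom.mk' (fun x => g.app i (s i x)) (fun x y => by
                rw [← map_add]; apply hk; simp [hs])
             app_act := fun n h x a => by
                simp only [AddMonoidHom.mk'_apply]
                rw [← g.app_act]
                apply hk
                simp [hs, f.app_act] }, by ext i x; exact hk _ _ _ (hs i _)⟩)

noncomputable instance : Abelian (GrMod 𝒜) where
  normalMonoOfMono f _ := ⟨normalMono f⟩
  normalEpiOfEpi f _ := ⟨normalEpi f⟩

instance : HasExt.{u + 1} (GrMod 𝒜) := HasExt.standard _

/-! ### Shifts, the modules `R_R` and `R / R_{≥ 1}`, torsion, finite generation -/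

/-- The shifted module `M[d]`, with `M[d]_i = M_{i + d}`. -/
def shift (M : GrMod 𝒜) (d : ℤ) : GrMod 𝒜 where
  deg i := M.deg (i + d)
  act n h := M.act n (by omega)
  act_one x := M.act_one x
  act_mul m n h h' x a b := M.act_mul m n _ _ x a b

variable (𝒜) in
/-- The functor `M ↦ M[d]`. -/
def shiftFunctor (d : ℤ) : GrMod 𝒜 ⥤ GrMod 𝒜 where
  obj M := M.shift d
  map f := { app := fun i => f.app (i + d), app_act := fun n h x a => f.app_act n _ x a }

variable (𝒜) in
/-- The grading of `R` extended by `0` to negative degrees. -/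
def zComp : ℤ → Submodule k R
  | .ofNat n => 𝒜 n
  | .negSucc _ => ⊥

theorem mul_mem_zComp {i j : ℤ} {n : ℕ} (h : i + n = j) {x a : R} (hx : x ∈ zComp 𝒜 i)
    (ha : a ∈ 𝒜 n) : x * a ∈ zComp 𝒜 j := by
  subst h
  cases i with
  | ofNat m => exact SetLike.GradedMul.mul_mem (A := 𝒜) hx ha
  | negSucc m =>
    have hx : x = 0 := hx
    rw [hx, zero_mul]
    exact zero_mem _

theorem zero_mul_mem_zComp {i : ℤ} {x a : R} (ha : a ∈ 𝒜 0) (hx : x ∈ zComp 𝒜 i) :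
    a * x ∈ zComp 𝒜 i := by
  cases i with
  | ofNat m =>
    have := SetLike.GradedMul.mul_mem (A := 𝒜) ha hx
    rwa [zero_add] at this
  | negSucc m =>
    have hx : x = 0 := hx
    rw [hx, mul_zero]
    exact zero_mem _

variable (𝒜) in
/-- The right module `R_R`, as an object of `Gr(R)`. -/
def self : GrMod 𝒜 where
  deg i := zComp 𝒜 i
  act n h := AddMonoidHom.mk' (fun x => AddMonoidHom.mk'
    (fun a => ⟨x * a, mul_mem_zComp h x.2 a.2⟩) (fun a b => by ext; simp [mul_add]))
    (fun x y => by ext; simp [add_mul])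
  act_one x := by ext; simp
  act_mul m n h h' x a b := by ext; simp [mul_assoc]

/-- The submodule `M_{≥ s}` of `M`. -/
def trunc (M : GrMod 𝒜) (s : ℤ) : GrMod 𝒜 where
  deg i := ({ carrier := {x | i < s → x = 0}
              add_mem' := fun hx hy h => by rw [hx h, hy h, add_zero]
              zero_mem' := fun _ => rfl
              neg_mem' := fun hx h => by rw [hx h, neg_zero] } : AddSubgroup (M.deg i))
  act {i j} n h := AddMonoidHom.mk' (fun x => AddMonoidHom.mk'
      (fun a => ⟨M.act n h x.1 a, fun hj => by
        rw [x.2 (by omega), map_zero, AddMonoidHom.zero_apply]⟩)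
      (fun a b => by ext; simp)) (fun x y => by ext; simp)
  act_one x := by ext; simp [M.act_one]
  act_mul m n h h' x a b := by ext; simp [M.act_mul]

/-- The inclusion `M_{≥ s} ⟶ M`. -/
def truncι (M : GrMod 𝒜) (s : ℤ) : M.trunc s ⟶ M where
  app _ := AddSubgroup.subtype _
  app_act _ _ _ _ := rfl

/-- The functoriality of `M ↦ M_{≥ s}`. -/
def truncMap {M N : GrMod 𝒜} (f : M ⟶ N) (s : ℤ) : M.trunc s ⟶ N.trunc s where
  app i := AddMonoidHom.mk' (fun x => ⟨f.app i x.1, fun h => by rw [x.2 h, map_zero]⟩)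
    (fun x y => Subtype.ext (map_add (f.app i) x.1 y.1))
  app_act n h x a := Subtype.ext (f.app_act n h x.1 a)

/-- The quotient `M / M_{≥ s}` in `Gr(R)`. -/
noncomputable def quot (M : GrMod 𝒜) (s : ℤ) : GrMod 𝒜 := cokernel (M.truncι s)

/-- The projection `M ⟶ M / M_{≥ s}`. -/
noncomputable def quotπ (M : GrMod 𝒜) (s : ℤ) : M ⟶ M.quot s := cokernel.π (M.truncι s)

instance (M : GrMod 𝒜) (s : ℤ) : Epi (M.quotπ s) :=
  inferInstanceAs (Epi (cokernel.π (M.truncι s)))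

/-- The functoriality of `M ↦ M / M_{≥ s}`. -/
noncomputable def quotMap {M N : GrMod 𝒜} (f : M ⟶ N) (s : ℤ) : M.quot s ⟶ N.quot s :=
  cokernel.map _ _ (truncMap f s) f rfl

theorem quotπ_quotMap {M N : GrMod 𝒜} (f : M ⟶ N) (s : ℤ) :
    M.quotπ s ≫ quotMap f s = f ≫ N.quotπ s :=
  cokernel.π_desc _ _ _

variable (𝒜) in
/-- Left multiplication by an element of `R_0`, as an endomorphism of `R_R`. -/
def lmul (a : 𝒜 0) : self 𝒜 ⟶ self 𝒜 where
  app i := AddMonoidHom.mk'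
    (fun x : zComp 𝒜 i => (⟨a * x, zero_mul_mem_zComp a.2 x.2⟩ : zComp 𝒜 i))
    (fun x y => Subtype.ext (mul_add (a : R) x.1 y.1))
  app_act _ _ x b := Subtype.ext (mul_assoc (a : R) (Subtype.val x) b).symm

variable (𝒜) in
/-- The ring homomorphism `R_0 → End(R_R)` given by left multiplications
(in `End X`, the product `f * g` is `f ∘ g`). -/
def leftMul : 𝒜 0 →+* End (self 𝒜) where
  toFun := lmul 𝒜
  map_one' := hom_ext fun _ _ => Subtype.ext (one_mul _)
  map_mul' _ _ := hom_ext fun _ _ => Subtype.ext (mul_assoc _ _ _)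
  map_zero' := hom_ext fun _ _ => Subtype.ext (zero_mul _)
  map_add' _ _ := hom_ext fun _ _ => Subtype.ext (add_mul _ _ _)

variable (𝒜) in
/-- The ring homomorphism `R_0 → End(R / R_{≥ s})` given by left multiplications. -/
noncomputable def leftMulQuot (s : ℤ) : 𝒜 0 →+* End ((self 𝒜).quot s) where
  toFun a := quotMap (leftMul 𝒜 a) s
  map_one' := (cancel_epi ((self 𝒜).quotπ s)).1 (by
    rw [quotπ_quotMap, map_one, End.one_def, End.one_def, Category.id_comp, Category.comp_id])
  map_mul' a b := (cancel_epi ((self 𝒜).quotπ s)).1 (by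
    rw [quotπ_quotMap, map_mul, End.mul_def, End.mul_def, Category.assoc, ← quotπ_quotMap,
      ← Category.assoc, ← quotπ_quotMap, Category.assoc])
  map_zero' := (cancel_epi ((self 𝒜).quotπ s)).1 (by
    rw [quotπ_quotMap, map_zero]
    exact zero_comp.trans comp_zero.symm)
  map_add' a b := (cancel_epi ((self 𝒜).quotπ s)).1 (by
    rw [quotπ_quotMap, map_add]
    refine (Preadditive.add_comp _ _ _ _ _ _).trans ?_
    rw [← quotπ_quotMap, ← quotπ_quotMap]
    exact (Preadditive.comp_add _ _ _ _ _ _).symm)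

/-- `M` is torsion if every (homogeneous) element `x` satisfies `x R_{≥ s} = 0` for some `s`. -/
def IsTorsion (M : GrMod 𝒜) : Prop :=
  ∀ (i : ℤ) (x : M.deg i), ∃ s : ℕ, ∀ n : ℕ, s ≤ n → ∀ (a : 𝒜 n), M.act n rfl x a = 0

/-- `M` is a finitely generated right `R`-module: there are finitely many homogeneous elements
`g t` such that every homogeneous element is a sum of elements of the form `g t · a`. -/
def IsFG (M : GrMod 𝒜) : Prop :=
  ∃ (r : ℕ) (e : Fin r → ℤ) (g : ∀ t, M.deg (e t)), ∀ (j : ℤ),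
    AddSubgroup.closure {y : M.deg j | ∃ (t : Fin r) (n : ℕ) (h : e t + n = j) (a : 𝒜 n),
      M.act n h (g t) a = y} = ⊤

theorem act_eq_zero_iff {M : GrMod 𝒜} {i j : ℤ} {n : ℕ} (h : i + n = j) (x : M.deg i) (a : 𝒜 n) :
    M.act n h x a = 0 ↔ M.act n rfl x a = 0 := by
  subst h
  rfl

/-- If every `x · a` with `a ∈ R_{≥ s}` homogeneous is torsion, then so is `x`. -/
theorem exists_act_eq_zero [IsNoetherianRing Rᵐᵒᵖ] {M : GrMod 𝒜} {i : ℤ} (x : M.deg i) (s : ℕ)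
    (H : ∀ n : ℕ, s ≤ n → ∀ a : 𝒜 n, ∃ t : ℕ, ∀ m : ℕ, t ≤ m → ∀ b : 𝒜 m,
      M.act m rfl (M.act n rfl x a) b = 0) :
    ∃ N : ℕ, ∀ n : ℕ, N ≤ n → ∀ a : 𝒜 n, M.act n rfl x a = 0 := by
  classical
  let φ : ∀ n : ℕ, R →+ M.deg (i + n) := fun n => AddMonoidHom.mk'
    (fun b => M.act n rfl x (decompose 𝒜 b n)) (fun a b => by simp)
  have hφ : ∀ (n : ℕ) (a : 𝒜 n), φ n a = M.act n rfl x a := fun n a => by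
    change M.act n rfl x (decompose 𝒜 (a : R) n) = _
    congr 1
    exact Subtype.ext (decompose_of_mem_same 𝒜 a.2)
  let S : Set Rᵐᵒᵖ := {z | ∃ n : ℕ, s ≤ n ∧ z.unop ∈ 𝒜 n}
  obtain ⟨T, hTS, hT⟩ := (Submodule.fg_span_iff_fg_span_finset_subset S).1
    (IsNoetherian.noetherian (Submodule.span Rᵐᵒᵖ S))
  have key : ∀ z ∈ T, ∃ N : ℕ, ∀ n : ℕ, N ≤ n → ∀ c : R, φ n (z.unop * c) = 0 := by
    intro z hz
    obtain ⟨m, hm, hzm⟩ := hTS hz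
    obtain ⟨t, ht⟩ := H m hm ⟨_, hzm⟩
    refine ⟨m + t, fun n hn c => ?_⟩
    obtain ⟨p, rfl⟩ : ∃ p, n = m + p := ⟨n - m, by omega⟩
    have h1 := ht p (by omega) (decompose 𝒜 c p)
    rw [← act_eq_zero_iff (j := i + (m + p : ℕ)) (by push_cast; omega), M.act_mul] at h1
    rw [← h1]
    change M.act (m + p) rfl x (decompose 𝒜 (z.unop * c) (m + p)) = _
    congr 1
    exact Subtype.ext (coe_decompose_mul_add_of_left_mem 𝒜 hzm)
  choose! N hN using key
  refine ⟨max s (T.sup N), fun n hn a => ?_⟩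
  rw [← hφ]
  have ha : MulOpposite.op (a : R) ∈ Submodule.span Rᵐᵒᵖ (T : Set Rᵐᵒᵖ) := by
    rw [← hT]
    exact Submodule.subset_span ⟨n, by omega, a.2⟩
  obtain ⟨c, -, hc⟩ := Submodule.mem_span_finset.1 ha
  have h2 : (a : R) = ∑ z ∈ T, z.unop * (c z).unop := by
    have := congrArg MulOpposite.unop hc
    simpa using this.symm
  rw [h2, map_sum]
  refine Finset.sum_eq_zero fun z hz => hN z hz n ?_ _
  have := Finset.le_sup (f := N) hz
  omega

end GrMod

open GrMod

variable (𝒜)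

/-! ### Module structures on Ext groups, and the condition `χ` -/

/-- If `S` acts on `X` from the left, then `Ext^j(X, Y)` is a right `S`-module:
`x · s` is the precomposition of `x` with the action of `s`. -/
@[reducible]
noncomputable def extModule {C : Type*} [Category C] [Abelian C] [HasExt.{u + 1} C] {S : Type*}
    [Ring S] {X : C} (ρ : S →+* End X) (Y : C) (j : ℕ) : Module Sᵐᵒᵖ (Ext X Y j) where
  smul s x := (Ext.mk₀ (ρ s.unop)).comp x (zero_add j)
  one_smul x := by
    change (Ext.mk₀ (ρ 1)).comp x (zero_add j) = x
    rw [map_one, End.one_def, Ext.mk₀_id_comp]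
  mul_smul s t x := by
    change (Ext.mk₀ (ρ (t.unop * s.unop))).comp x (zero_add j) =
      (Ext.mk₀ (ρ s.unop)).comp ((Ext.mk₀ (ρ t.unop)).comp x (zero_add j)) (zero_add j)
    rw [Ext.mk₀_comp_mk₀_assoc, map_mul, End.mul_def]
  smul_zero s := Ext.comp_zero _ _ _ _ _
  smul_add s x y := Ext.comp_add _ _ _ _
  add_smul s t x := by
    change (Ext.mk₀ (ρ (s.unop + t.unop))).comp x (zero_add j) =
      (Ext.mk₀ (ρ s.unop)).comp x (zero_add j) + (Ext.mk₀ (ρ t.unop)).comp x (zero_add j)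
    rw [map_add, ← Ext.add_comp, Ext.mk₀_add]
  zero_smul x := by
    change (Ext.mk₀ (ρ 0)).comp x (zero_add j) = 0
    rw [map_zero, Ext.mk₀_zero, Ext.zero_comp]

variable {𝒜} in
/-- The degree `d` component `Ext^j_{Gr(R)}(R / R_{≥ 1}, M[d])` of the graded Ext group
from `R / R_{≥ 1}` to `M`. -/
def GrExtRes (M : GrMod 𝒜) (j : ℕ) (d : ℤ) : Type (u + 1) :=
  Ext ((self 𝒜).quot 1) (M.shift d) j

noncomputable instance (M : GrMod 𝒜) (j : ℕ) (d : ℤ) : AddCommGroup (GrExtRes M j d) :=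
  inferInstanceAs (AddCommGroup (Ext ((self 𝒜).quot 1) (M.shift d) j))

/-- The right `R_0`-module structure coming from left multiplication on `R / R_{≥ 1}`. -/
noncomputable instance (M : GrMod 𝒜) (j : ℕ) (d : ℤ) : Module (𝒜 0)ᵐᵒᵖ (GrExtRes M j d) :=
  extModule (leftMulQuot 𝒜 1) (M.shift d) j

/-- The condition `χ_i`: for every finitely generated graded right module `M` and all `j ≤ i`, the
graded Ext group from `R / R_{≥ 1}` to `M` in degree `j` (the direct sum over all shifts of `M`) is
finitely generated. Here `R` acts on it from the right through left multiplication on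
`R / R_{≥ 1}`, so that `R_{≥ 1}` acts by zero, and being finitely generated over `R` and over `R_0`
is the same thing. -/
def ChiUpTo (i : ℕ) : Prop :=
  ∀ M : GrMod 𝒜, M.IsFG → ∀ j ≤ i, Module.Finite (𝒜 0)ᵐᵒᵖ (⨁ d : ℤ, GrExtRes M j d)

/-- The condition `χ`: `χ_i` holds for every `i`. -/
def Chi : Prop := ∀ i, ChiUpTo 𝒜 i

/-! ### The quotient category `QGr(R)` -/

/-- The full subcategory `Tor(R)` of torsion modules. -/
def tor : ObjectProperty (GrMod 𝒜) := IsTorsion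

variable [IsNoetherianRing Rᵐᵒᵖ]

/-- For `R` right Noetherian, `Tor(R)` is a thick (Serre) subcategory of `Gr(R)`. -/
instance : (tor 𝒜).IsSerreClass where
  exists_zero := ⟨zeroObj, isZero_zeroObj, fun _ _ => ⟨0, fun _ _ _ => rfl⟩⟩
  prop_of_mono {X Y} f _ hY := fun i x => by
    obtain ⟨s, hs⟩ := hY i (f.app i x)
    refine ⟨s, fun n hn a => injective_of_mono f _ ?_⟩
    rw [f.app_act, hs n hn, map_zero]
  prop_of_epi {X Y} f _ hX := fun i y => by
    obtain ⟨x, rfl⟩ := surjective_of_epi f i y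
    obtain ⟨s, hs⟩ := hX i x
    refine ⟨s, fun n hn a => ?_⟩
    rw [← f.app_act, hs n hn, map_zero]
  prop_X₂_of_shortExact {S} hS h₁ h₃ := fun i x => by
    obtain ⟨s, hs⟩ := h₃ i (S.g.app i x)
    refine exists_act_eq_zero x s fun n hn a => ?_
    have hy : S.g.app _ (S.X₂.act n rfl x a) = 0 := by rw [S.g.app_act, hs n hn]
    let l : ker S.g ⟶ S.X₁ := hS.fIsKernel.lift (KernelFork.ofι (kerι S.g) (kerι_comp S.g))
    have hl : l ≫ S.f = kerι S.g := hS.fIsKernel.fac _ WalkingParallelPair.zero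
    have hz : S.f.app _ (l.app _ ⟨_, hy⟩) = S.X₂.act n rfl x a :=
      congrArg (fun g : ker S.g ⟶ S.X₂ => g.app _ ⟨_, hy⟩) hl
    obtain ⟨t, ht⟩ := h₁ _ (l.app _ ⟨_, hy⟩)
    refine ⟨t, fun m hm b => ?_⟩
    rw [← hz, ← S.f.app_act, ht m hm, map_zero]

/-- The quotient category `QGr(R) = Gr(R) / Tor(R)`. -/
abbrev QGr : Type (u + 1) := (tor 𝒜).isoModSerre.Localization

/-- The quotient functor `π : Gr(R) ⥤ QGr(R)`. -/
noncomputable abbrev π : GrMod 𝒜 ⥤ QGr 𝒜 := (tor 𝒜).isoModSerre.Q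

noncomputable instance : Abelian (QGr 𝒜) :=
  ObjectProperty.SerreClassLocalization.abelian (π 𝒜) (tor 𝒜)

instance : HasExt.{u + 1} (QGr 𝒜) := HasExt.standard _

variable {𝒜} in
theorem isoModSerre_shift (d : ℤ) {M N : GrMod 𝒜} (f : M ⟶ N) (hf : (tor 𝒜).isoModSerre f) :
    (tor 𝒜).isoModSerre ((shiftFunctor 𝒜 d).map f) := by
  have h : ∀ P : GrMod 𝒜, tor 𝒜 P → tor 𝒜 (P.shift d) := fun P hP i x => by
    obtain ⟨s, hs⟩ := hP _ x
    exact ⟨s, fun n hn a => (act_eq_zero_iff (M := P) (by omega) _ _).2 (hs n hn a)⟩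
  have hk : ∀ {M N : GrMod 𝒜} (f : M ⟶ N), tor 𝒜 (kernel f) ↔ tor 𝒜 (ker f) := fun f =>
    (tor 𝒜).prop_iff_of_iso (IsLimit.conePointUniqueUpToIso (kernelIsKernel f) (isLimitKer f))
  have hc : ∀ {M N : GrMod 𝒜} (f : M ⟶ N), tor 𝒜 (cokernel f) ↔ tor 𝒜 (coker f) := fun f =>
    (tor 𝒜).prop_iff_of_iso
      (IsColimit.coconePointUniqueUpToIso (cokernelIsCokernel f) (isColimitCoker f))
  exact ⟨(hk _).2 (h _ ((hk f).1 hf.1)), (hc _).2 (h _ ((hc f).1 hf.2))⟩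

/-- The autoequivalence `ℱ ↦ ℱ[d]` of `QGr(R)` induced by `M ↦ M[d]`. -/
noncomputable def qshift (d : ℤ) : QGr 𝒜 ⥤ QGr 𝒜 :=
  Localization.lift (shiftFunctor 𝒜 d ⋙ π 𝒜) (fun _ _ f hf =>
    Localization.inverts (π 𝒜) (tor 𝒜).isoModSerre _ (isoModSerre_shift d f hf)) (π 𝒜)

/-- The left action of `R_0` on `ℛ = π R`. -/
noncomputable def leftMulQ : 𝒜 0 →+* End ((π 𝒜).obj (self 𝒜)) where
  toFun a := (π 𝒜).map (leftMul 𝒜 a)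
  map_one' := by rw [map_one]; exact (π 𝒜).map_id _
  map_mul' a b := by rw [map_mul]; exact (π 𝒜).map_comp _ _
  map_zero' := by rw [map_zero]; exact (π 𝒜).map_zero _ _
  map_add' a b := by rw [map_add]; exact (π 𝒜).map_add

/-! ### Cohomology -/

/-- `H^j(ℱ) = Ext^j(ℛ, ℱ)`, the Yoneda extension group in `QGr(R)`. -/
def H (j : ℕ) (ℱ : QGr 𝒜) : Type (u + 1) := Ext ((π 𝒜).obj (self 𝒜)) ℱ j

noncomputable instance (j : ℕ) (ℱ : QGr 𝒜) : AddCommGroup (H 𝒜 j ℱ) :=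
  inferInstanceAs (AddCommGroup (Ext ((π 𝒜).obj (self 𝒜)) ℱ j))

/-- The right `R_0`-module structure of `H^j(ℱ)`, coming from left multiplication on `R`. -/
noncomputable instance (j : ℕ) (ℱ : QGr 𝒜) : Module (𝒜 0)ᵐᵒᵖ (H 𝒜 j ℱ) :=
  extModule (leftMulQ 𝒜) ℱ j

end
end NCProj

/-! ### Graded modules: exactness, maps out of $R$ and $R/R_{\ge 1}$, torsion. -/

namespace NCProj

namespace GrMod

variable {k : Type w} {R : Type u} [CommRing k] [Ring R] [Algebra k R]
  {𝒜 : ℕ → Submodule k R} [GradedAlgebra 𝒜]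

/-! ### Graded submodules and exactness -/

/-! Write $K = R/R_{\ge 1}$. A Noetherian object of $\mathrm{QGr}(R)$ is $\pi N$ with $N$ finitely
generated (`exists_isFG_iso`), so $\mathrm{Ext}^j(\pi R, \pi N[d])$ has to be controlled. This is
done by dimension shifting along torsion-free injectives $I$ of $\mathrm{Gr}(R)$: for these $\pi I$
is injective (`injective_obj_π`) and $\mathrm{Hom}(R, I) = \mathrm{Hom}(\pi R, \pi I)$
(`homToH_bijective`). There are enough of them because, $R$ being right Noetherian, an essential
extension of a torsion module is torsion, so the torsion submodule of an injective module splits off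
(`exists_tors_retraction`).

Cosyzygies need not be finitely generated, so $\chi$ does not apply to them directly. What survives
is `HasFiniteExt`: every $\mathrm{Ext}^j(K, M[d])$ is finite over $R_0$, and it vanishes for $d \gg
0$. Finitely generated modules have this property by $\chi$. If $M$ has it, then its torsion
submodule $\tau M$ is bounded above with finitely generated truncations
(`HasFiniteExt.isCofinite_tors`); hence $\tau M$ and $M/\tau M$ have it. Embed $M/\tau M$ in a
torsion-free $I$ with all shifts injective. Since $\mathrm{Ext}^*(K, I[d]) = 0$, the quotient $N =
I/(M/\tau M)$ has it as well.

Now $H^{j+1}(\pi M[d])$ is a quotient of $H^j(\pi N[d])$, and for $j = 0$ even of the cokernel of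
$N_d \to H^0(\pi N[d])$. For any $M$ as above, the cokernel of $M_d \to H^0(\pi M[d])$ is a
subquotient of $(\tau N)_d$, so it is finite over $R_0$ and zero for $d \gg 0$
(`HasFiniteExt.homToH_coker`). Induction on $j$ settles positive degrees
(`HasFiniteExt.cohomology`). For $H^0$, $M_d$ is itself finite over $R_0$ when $M$ is finitely
generated (`finite_H_zero`). -/

theorem mono_of_injective {M N : GrMod 𝒜} {f : M ⟶ N} (h : ∀ i, Function.Injective (f.app i)) :
    Mono f where
  right_cancellation a b hab := by
    ext i x
    exact h i (congrArg (fun l => Hom.app l i x) hab)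

theorem epi_of_surjective {M N : GrMod 𝒜} {f : M ⟶ N} (h : ∀ i, Function.Surjective (f.app i)) :
    Epi f where
  left_cancellation a b hab := by
    ext i x
    obtain ⟨x, rfl⟩ := h i x
    exact congrArg (fun l => Hom.app l i x) hab

/-- A family of subgroups is closed under the action of `R`. -/
def IsClosedUnder (M : GrMod 𝒜) (c : ∀ i, AddSubgroup (M.deg i)) : Prop :=
  ∀ {i j : ℤ} (n : ℕ) (h : i + n = j) (x : M.deg i) (a : 𝒜 n), x ∈ c i → M.act n h x a ∈ c j

/-- The graded submodule with given components. -/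
def sub (M : GrMod 𝒜) (c : ∀ i, AddSubgroup (M.deg i)) (hc : M.IsClosedUnder c) : GrMod 𝒜 where
  deg i := c i
  act {i j} n h := AddMonoidHom.mk' (fun x => AddMonoidHom.mk'
      (fun a => ⟨M.act n h x.1 a, hc n h x.1 a x.2⟩)
      (fun a b => by ext; simp)) (fun x y => by ext; simp)
  act_one x := by ext; simp [M.act_one]
  act_mul m n h h' x a b := by ext; simp [M.act_mul]

/-- The inclusion of a graded submodule. -/
def subι (M : GrMod 𝒜) (c : ∀ i, AddSubgroup (M.deg i)) (hc : M.IsClosedUnder c) :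
    M.sub c hc ⟶ M where
  app _ := AddSubgroup.subtype _
  app_act _ _ _ _ := rfl

theorem subι_injective (M : GrMod 𝒜) (c : ∀ i, AddSubgroup (M.deg i)) (hc : M.IsClosedUnder c)
    (i : ℤ) : Function.Injective ((M.subι c hc).app i) := Subtype.val_injective

/-- Factorization of a morphism through a graded submodule. -/
def subLift {M N : GrMod 𝒜} {c : ∀ i, AddSubgroup (M.deg i)} (hc : M.IsClosedUnder c)
    (f : N ⟶ M) (hf : ∀ i x, f.app i x ∈ c i) : N ⟶ M.sub c hc where
  app i := (f.app i).codRestrict (c i) (hf i)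
  app_act n h x a := Subtype.ext (f.app_act n h x a)

/-- The inclusion between two graded submodules. -/
def subMap (M : GrMod 𝒜) {c c' : ∀ i, AddSubgroup (M.deg i)} (hc : M.IsClosedUnder c)
    (hc' : M.IsClosedUnder c') (h : c ≤ c') : M.sub c hc ⟶ M.sub c' hc' :=
  subLift hc' (M.subι c hc) (fun i x => h i x.2)

/-- Degreewise short exactness. -/
structure IsSES {A B C : GrMod 𝒜} (f : A ⟶ B) (g : B ⟶ C) : Prop where
  inj : ∀ i, Function.Injective (f.app i)
  surj : ∀ i, Function.Surjective (g.app i)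
  exact : ∀ i x, g.app i x = 0 ↔ ∃ y, f.app i y = x

theorem IsSES.comp_eq_zero {A B C : GrMod 𝒜} {f : A ⟶ B} {g : B ⟶ C} (h : IsSES f g) :
    f ≫ g = 0 := by
  ext i x
  exact (h.exact i _).2 ⟨x, rfl⟩

theorem IsSES.shortExact {A B C : GrMod 𝒜} {f : A ⟶ B} {g : B ⟶ C} (h : IsSES f g) :
    (ShortComplex.mk f g h.comp_eq_zero).ShortExact := by
  have : Mono f := mono_of_injective h.inj
  have : Epi g := epi_of_surjective h.surj
  refine ShortComplex.ShortExact.mk' (ShortComplex.exact_of_f_is_kernel _ ?_) ‹_› ‹_›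
  refine KernelFork.IsLimit.ofι' _ _ fun {P} l hl => ?_
  have hr : ∀ i x, ∃ y, f.app i y = l.app i x := fun i x =>
    (h.exact i _).1 (congrArg (fun t => Hom.app t i x) hl)
  choose r hr using hr
  exact ⟨{ app := fun i => AddMonoidHom.mk' (r i) (fun x y => h.inj i (by simp [hr]))
           app_act := fun n h' x a => h.inj _ (by simp [hr, f.app_act, l.app_act]) },
    by ext i x; exact hr i x⟩

/-- The functoriality of `M ↦ M[d]`. -/
def shiftMap {M N : GrMod 𝒜} (f : M ⟶ N) (d : ℤ) : M.shift d ⟶ N.shift d :=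
  (shiftFunctor 𝒜 d).map f

theorem shiftMap_comp {M N P : GrMod 𝒜} (f : M ⟶ N) (g : N ⟶ P) (d : ℤ) :
    shiftMap f d ≫ shiftMap g d = shiftMap (f ≫ g) d := rfl

theorem shiftMap_id (M : GrMod 𝒜) (d : ℤ) : shiftMap (𝟙 M) d = 𝟙 _ := rfl

theorem IsSES.shift {A B C : GrMod 𝒜} {f : A ⟶ B} {g : B ⟶ C} (h : IsSES f g) (d : ℤ) :
    IsSES (shiftMap f d) (shiftMap g d) where
  inj i := h.inj (i + d)
  surj i := h.surj (i + d)
  exact i x := h.exact (i + d) x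

theorem isSES_of_injective {A B : GrMod 𝒜} {f : A ⟶ B}
    (h : ∀ i, Function.Injective (f.app i)) : IsSES f (cokerπ f) where
  inj := h
  surj _ := QuotientAddGroup.mk_surjective
  exact _ _ := QuotientAddGroup.eq_zero_iff _

theorem IsSES.exists_desc {A B C D : GrMod 𝒜} {f : A ⟶ B} {g : B ⟶ C} (h : IsSES f g)
    (l : B ⟶ D) (hl : f ≫ l = 0) : ∃ r : C ⟶ D, g ≫ r = l :=
  ⟨h.shortExact.gIsCokernel.desc (CokernelCofork.ofπ l hl),
    h.shortExact.gIsCokernel.fac _ WalkingParallelPair.one⟩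

theorem IsSES.exists_lift {A B C D : GrMod 𝒜} {f : A ⟶ B} {g : B ⟶ C} (h : IsSES f g)
    (l : D ⟶ B) (hl : l ≫ g = 0) : ∃ r : D ⟶ A, r ≫ f = l :=
  ⟨h.shortExact.fIsKernel.lift (KernelFork.ofι l hl),
    h.shortExact.fIsKernel.fac _ WalkingParallelPair.zero⟩

/-! ### Morphisms out of `R` -/

/-- The element `1` of degree `0` in `R`. -/
def selfOne : (self 𝒜).deg 0 := (⟨1, SetLike.GradedOne.one_mem⟩ : 𝒜 0)

theorem self_act_one (n : ℕ) (x : (self 𝒜).deg n) :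
    (self 𝒜).act n (by simp) selfOne (⟨x.1, x.2⟩ : 𝒜 n) = x :=
  Subtype.ext (one_mul _)

theorem self_hom_ext {M : GrMod 𝒜} {f g : self 𝒜 ⟶ M}
    (h : f.app 0 selfOne = g.app 0 selfOne) : f = g := by
  ext i x
  cases i with
  | ofNat n =>
    rw [← self_act_one n x, f.app_act, g.app_act, h]
  | negSucc n =>
    have : x = 0 := Subtype.ext x.2
    rw [this, map_zero, map_zero]

/-- The morphism `R ⟶ M` with `1 ↦ x`. -/
def ofElem {M : GrMod 𝒜} (x : M.deg 0) : self 𝒜 ⟶ M where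
  app i := match i with
    | .ofNat n => (M.act n (zero_add (n : ℤ)) x : 𝒜 n →+ M.deg n)
    | .negSucc _ => 0
  app_act {i j} n h y a := by
    subst h
    cases i with
    | ofNat m =>
      exact (M.act_mul m n _ _ x y a).symm
    | negSucc m =>
      have : y = 0 := Subtype.ext y.2
      rw [this]
      simp

theorem ofElem_one {M : GrMod 𝒜} (x : M.deg 0) : (ofElem x).app 0 selfOne = x := M.act_one x

/-- Elements of `M` annihilated by `R_{≥ 1}` are images of `1` under morphisms from
`R / R_{≥ 1}`. -/
theorem exists_quot_hom {M : GrMod 𝒜} (x : M.deg 0)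
    (hx : ∀ n : ℕ, 1 ≤ n → ∀ a : 𝒜 n, M.act n rfl x a = 0) :
    ∃ f : (self 𝒜).quot 1 ⟶ M, (quotπ _ _ ≫ f).app 0 selfOne = x := by
  have h : (self 𝒜).truncι 1 ≫ ofElem x = 0 := by
    ext i y
    cases i with
    | ofNat n =>
      rcases Nat.eq_zero_or_pos n with rfl | hn
      · have : y = 0 := Subtype.ext (y.2 (by simp))
        rw [this, map_zero, map_zero]
      · exact (act_eq_zero_iff (M := M) _ x _).2 (hx n hn _)
    | negSucc n => rfl
  exact ⟨cokernel.desc _ _ h,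
    (congrArg (fun l => Hom.app l 0 selfOne) (cokernel.π_desc _ _ h)).trans (ofElem_one x)⟩

/-- Together with `exists_quot_hom` and `quot_hom_eq_zero`, this identifies $\mathrm{Hom}(R/R_{\ge
1}, M)$ with the elements of $M_0$ killed by $R_{\ge 1}$. -/
theorem quot_hom_act {M : GrMod 𝒜} (f : (self 𝒜).quot 1 ⟶ M) (n : ℕ) (hn : 1 ≤ n) (a : 𝒜 n) :
    M.act n rfl ((quotπ _ _ ≫ f).app 0 selfOne) a = 0 := by
  rw [← Hom.app_act]
  have h : (self 𝒜).truncι 1 ≫ quotπ _ _ = 0 := cokernel.condition _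
  have h : (self 𝒜).truncι 1 ≫ quotπ _ _ ≫ f = 0 := by rw [← Category.assoc, h, zero_comp]
  exact congrArg (fun l => Hom.app l _
    (⟨(self 𝒜).act n rfl selfOne a, fun h => absurd h (by omega)⟩ : ((self 𝒜).trunc 1).deg _)) h

theorem quot_hom_eq_zero {M : GrMod 𝒜} (f : (self 𝒜).quot 1 ⟶ M)
    (h : (quotπ _ _ ≫ f).app 0 selfOne = 0) : f = 0 := by
  rw [← cancel_epi (quotπ _ _), comp_zero]
  exact self_hom_ext h

/-- `R` is projective. -/
theorem exists_self_lift {A B : GrMod 𝒜} (g : A ⟶ B) (hg : ∀ i, Function.Surjective (g.app i))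
    (f : self 𝒜 ⟶ B) : ∃ l : self 𝒜 ⟶ A, l ≫ g = f := by
  obtain ⟨x, hx⟩ := hg 0 (f.app 0 selfOne)
  exact ⟨ofElem x, self_hom_ext (by rw [comp_app, ofElem_one, hx])⟩

/-! ### Torsion submodules -/

/-- The (homogeneous) element `x` satisfies `x R_{≥ s} = 0` for some `s`. -/
def IsTors (M : GrMod 𝒜) {i : ℤ} (x : M.deg i) : Prop :=
  ∃ s : ℕ, ∀ n : ℕ, s ≤ n → ∀ (a : 𝒜 n), M.act n rfl x a = 0

theorem IsTors.map {M N : GrMod 𝒜} (f : M ⟶ N) {i : ℤ} {x : M.deg i} (h : M.IsTors x) :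
    N.IsTors (f.app i x) := by
  obtain ⟨s, hs⟩ := h
  exact ⟨s, fun n hn a => by rw [← f.app_act, hs n hn, map_zero]⟩

theorem IsTors.of_map {M N : GrMod 𝒜} (f : M ⟶ N) (hf : ∀ i, Function.Injective (f.app i))
    {i : ℤ} {x : M.deg i} (h : N.IsTors (f.app i x)) : M.IsTors x := by
  obtain ⟨s, hs⟩ := h
  exact ⟨s, fun n hn a => hf _ (by rw [f.app_act, hs n hn, map_zero])⟩

theorem IsTors.add {M : GrMod 𝒜} {i : ℤ} {x y : M.deg i} (hx : M.IsTors x) (hy : M.IsTors y) :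
    M.IsTors (x + y) := by
  obtain ⟨s, hs⟩ := hx
  obtain ⟨t, ht⟩ := hy
  exact ⟨max s t, fun n hn a => by simp [hs n (by omega), ht n (by omega)]⟩

theorem IsTors.act {M : GrMod 𝒜} {i j : ℤ} {x : M.deg i} (hx : M.IsTors x) (n : ℕ)
    (h : i + n = j) (a : 𝒜 n) : M.IsTors (M.act n h x a) := by
  obtain ⟨s, hs⟩ := hx
  refine ⟨s, fun m hm b => ?_⟩
  rw [M.act_mul, act_eq_zero_iff]
  exact hs _ (by omega) _

variable (𝒜) in
/-- A module without nonzero torsion elements. -/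
def IsTorsionFree (M : GrMod 𝒜) : Prop := ∀ (i : ℤ) (x : M.deg i), M.IsTors x → x = 0

theorem isTors_shift_iff {M : GrMod 𝒜} {d i : ℤ} (x : M.deg (i + d)) :
    (M.shift d).IsTors (i := i) x ↔ M.IsTors x := by
  refine exists_congr fun s => forall_congr' fun n => forall_congr' fun _ => forall_congr' fun a => ?_
  exact act_eq_zero_iff (M := M) (by omega) x a

theorem isTorsion_shift {M : GrMod 𝒜} (h : M.IsTorsion) (d : ℤ) : (M.shift d).IsTorsion :=
  fun i x => (isTors_shift_iff x).2 (h (i + d) x)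

theorem IsTorsionFree.shift {M : GrMod 𝒜} (h : IsTorsionFree 𝒜 M) (d : ℤ) :
    IsTorsionFree 𝒜 (M.shift d) :=
  fun i x hx => h (i + d) x ((isTors_shift_iff x).1 hx)

theorem IsTorsionFree.of_injective {M N : GrMod 𝒜} (h : IsTorsionFree 𝒜 N) (f : M ⟶ N)
    (hf : ∀ i, Function.Injective (f.app i)) : IsTorsionFree 𝒜 M :=
  fun i x hx => hf i (by rw [h i _ (hx.map f), map_zero])

/-- The components of the torsion submodule. -/
def torsC (M : GrMod 𝒜) (i : ℤ) : AddSubgroup (M.deg i) where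
  carrier := {x | M.IsTors x}
  add_mem' := IsTors.add
  zero_mem' := ⟨0, fun _ _ _ => by simp⟩
  neg_mem' := fun ⟨s, hs⟩ => ⟨s, fun n hn a => by simp [hs n hn]⟩

theorem torsC_closed (M : GrMod 𝒜) : M.IsClosedUnder M.torsC :=
  fun n h _ a hx => IsTors.act hx n h a

/-- The torsion submodule. -/
def tors (M : GrMod 𝒜) : GrMod 𝒜 := M.sub M.torsC M.torsC_closed

/-- The inclusion of the torsion submodule. -/
def torsι (M : GrMod 𝒜) : M.tors ⟶ M := M.subι _ _

theorem torsι_injective (M : GrMod 𝒜) (i : ℤ) : Function.Injective (M.torsι.app i) :=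
  M.subι_injective _ _ i

theorem isTorsion_tors (M : GrMod 𝒜) : M.tors.IsTorsion :=
  fun _ x => IsTors.of_map M.torsι M.torsι_injective x.2

/-- The quotient by the torsion submodule. -/
def modTors (M : GrMod 𝒜) : GrMod 𝒜 := coker M.torsι

/-- The projection to the quotient by the torsion submodule. -/
def modTorsπ (M : GrMod 𝒜) : M ⟶ M.modTors := cokerπ M.torsι

theorem isSES_tors (M : GrMod 𝒜) : IsSES M.torsι M.modTorsπ :=
  isSES_of_injective M.torsι_injective

/-- Modulo a torsion submodule, torsion elements come from torsion elements. -/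
theorem IsSES.isTors_of_isTors [IsNoetherianRing Rᵐᵒᵖ] {A B C : GrMod 𝒜} {f : A ⟶ B} {g : B ⟶ C}
    (h : IsSES f g) (hA : A.IsTorsion) {i : ℤ} {x : B.deg i} (hx : C.IsTors (g.app i x)) :
    B.IsTors x := by
  obtain ⟨s, hs⟩ := hx
  -- Each `x · a` with `a` of degree at least `s` comes from `A`, hence is killed by some $R_{\ge
  -- t}$ with `t` depending on `a`; right Noetherianity makes the bound uniform.
  refine exists_act_eq_zero x s fun n hn a => ?_
  obtain ⟨y, hy⟩ := (h.exact _ _).1 ((g.app_act n rfl x a).trans (hs n hn a))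
  rw [← hy]
  exact IsTors.map f (hA _ y)

theorem isTorsionFree_modTors [IsNoetherianRing Rᵐᵒᵖ] (M : GrMod 𝒜) :
    IsTorsionFree 𝒜 M.modTors := by
  intro i x hx
  obtain ⟨x, rfl⟩ := M.isSES_tors.surj i x
  exact (M.isSES_tors.exact i x).2 ⟨⟨x, M.isSES_tors.isTors_of_isTors M.isTorsion_tors hx⟩, rfl⟩

theorem hom_eq_zero_of_isTorsion {M N : GrMod 𝒜} (hM : M.IsTorsion) (hN : IsTorsionFree 𝒜 N)
    (f : M ⟶ N) : f = 0 := by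
  ext i x
  exact hN i _ (IsTors.map f (hM i x))

end GrMod

end NCProj

/-! ### Coinduced injectives, and vanishing of Ext for degree reasons. -/

namespace NCProj

namespace GrMod

variable {k : Type w} {R : Type u} [CommRing k] [Ring R] [Algebra k R]
  {𝒜 : ℕ → Submodule k R} [GradedAlgebra 𝒜]

/-! ### Cofree modules -/

/-- The extension property of injective abelian groups. -/
def IsInjGroup (Q : Type u) [AddCommGroup Q] : Prop :=
  ∀ (X Y : Type u) [AddCommGroup X] [AddCommGroup Y] (f : X →+ Y) (g : X →+ Q),
    Function.Injective f → ∃ h : Y →+ Q, ∀ x, h (f x) = g x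

/-- The clause on `Subsingleton` makes the injective modules built from these groups vanish in
nonnegative degrees when the given module does. -/
theorem exists_isInjGroup (A : Type u) [AddCommGroup A] :
    ∃ (Q : Type u) (_ : AddCommGroup Q) (ι : A →+ Q), Function.Injective ι ∧
      (Subsingleton A → Subsingleton Q) ∧ IsInjGroup Q := by
  by_cases hA : Subsingleton A
  · exact ⟨A, inferInstance, AddMonoidHom.id A, Function.injective_id, id,
      fun X Y _ _ f g _ => ⟨0, fun x => Subsingleton.elim _ _⟩⟩
  · refine ⟨(Injective.under (AddCommGrpCat.of A) : AddCommGrpCat.{u}), inferInstance,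
      (Injective.ι (AddCommGrpCat.of A)).hom, (AddCommGrpCat.mono_iff_injective _).1 inferInstance,
      fun h => absurd h hA, fun X Y _ _ f g hf => ?_⟩
    have : Mono (AddCommGrpCat.ofHom f) := (AddCommGrpCat.mono_iff_injective _).2 hf
    refine ⟨(Injective.factorThru (J := Injective.under (AddCommGrpCat.of A))
      (AddCommGrpCat.ofHom g) (AddCommGrpCat.ofHom f)).hom, fun x => ?_⟩
    exact congrArg (fun l => AddCommGrpCat.Hom.hom l x) (Injective.comp_factorThru
      (J := Injective.under (AddCommGrpCat.of A)) (AddCommGrpCat.ofHom g) (AddCommGrpCat.ofHom f))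

variable (𝒜) in
/-- The cofree graded module on a family of abelian groups, shifted by `c`. -/
def cofree (Q : ℤ → Type u) [∀ i, AddCommGroup (Q i)] (c : ℤ) : GrMod 𝒜 where
  -- Degree `i` is $\prod_n \mathrm{Hom}(R_n, Q_{i+n+c})$. The target degree is a separate index
  -- with an equation, and `c` is kept as a parameter, so that shifting needs no transport along
  -- equalities of degrees.
  deg i := ∀ p : {p : ℕ × ℤ // i + p.1 + c = p.2}, 𝒜 p.1.1 →+ Q p.1.2
  act {i j} n h := AddMonoidHom.mk' (fun φ => AddMonoidHom.mk' (fun a => fun p =>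
      (φ ⟨(n + p.1.1, p.1.2), by have := p.2; push_cast; omega⟩).comp (AddMonoidHom.mk'
        (fun b : 𝒜 p.1.1 => (⟨a * b, SetLike.GradedMul.mul_mem a.2 b.2⟩ : 𝒜 (n + p.1.1)))
        (fun b b' => by ext; simp [mul_add])))
      (fun a a' => by
        funext p
        ext b
        exact (congrArg (φ _) (Subtype.ext (add_mul (a : R) a' b))).trans
          (map_add (φ ⟨(n + p.1.1, p.1.2), _⟩) ⟨a * b, SetLike.GradedMul.mul_mem a.2 b.2⟩
            ⟨a' * b, SetLike.GradedMul.mul_mem a'.2 b.2⟩))) (fun φ ψ => by ext; rfl)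
  act_one {i} φ := by
    funext ⟨⟨m, l⟩, hl⟩
    ext b
    have key : ∀ (m' : ℕ) (h' : i + m' + c = l) (b' : 𝒜 m'), m' = m → (b' : R) = b →
        φ ⟨(m', l), h'⟩ b' = φ ⟨(m, l), hl⟩ b := by
      rintro m' h' b' rfl hb
      exact congrArg _ (Subtype.ext hb)
    exact key (0 + m) _ ⟨1 * b, _⟩ (zero_add m) (one_mul (b : R))
  act_mul {i j l} m n h h' φ a b := by
    funext ⟨⟨p, q⟩, hq⟩
    ext e
    have key : ∀ (m' m'' : ℕ) (h' : i + m' + c = q) (h'' : i + m'' + c = q) (b' : 𝒜 m')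
        (b'' : 𝒜 m''), m' = m'' → (b' : R) = b'' →
        φ ⟨(m', q), h'⟩ b' = φ ⟨(m'', q), h''⟩ b'' := by
      rintro m' _ h' h'' b' b'' rfl hb
      exact congrArg _ (Subtype.ext hb)
    exact key (m + (n + p)) (m + n + p) _ _ ⟨a * (b * e), _⟩ ⟨a * b * e, _⟩
      (add_assoc _ _ _).symm (mul_assoc (a : R) b e).symm

/-- The components of an element of a cofree module. -/
def cofreeEval {Q : ℤ → Type u} [∀ i, AddCommGroup (Q i)] {c i : ℤ} (n : ℕ) (j : ℤ)
    (h : i + n + c = j) : (cofree 𝒜 Q c).deg i →+ 𝒜 n →+ Q j :=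
  Pi.evalAddMonoidHom (fun p : {p : ℕ × ℤ // i + p.1 + c = p.2} => 𝒜 p.1.1 →+ Q p.1.2) ⟨(n, j), h⟩

theorem cofree_ext {Q : ℤ → Type u} [∀ i, AddCommGroup (Q i)] {c i : ℤ}
    {φ ψ : (cofree 𝒜 Q c).deg i}
    (h : ∀ (n : ℕ) (j : ℤ) (h : i + n + c = j) (a : 𝒜 n), cofreeEval n j h φ a = cofreeEval n j h ψ a) : φ = ψ := by
  funext ⟨⟨n, j⟩, hj⟩
  ext a
  exact h n j hj a

theorem cofreeEval_congr {Q : ℤ → Type u} [∀ i, AddCommGroup (Q i)] {c i j : ℤ}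
    (φ : (cofree 𝒜 Q c).deg i) {m n : ℕ} (h : i + m + c = j) (h' : i + n + c = j) (a : 𝒜 m)
    (b : 𝒜 n) (hmn : m = n) (hab : (a : R) = b) :
    cofreeEval m j h φ a = cofreeEval n j h' φ b := by
  subst hmn
  exact congrArg _ (Subtype.ext hab)

theorem cofreeEval_act {Q : ℤ → Type u} [∀ i, AddCommGroup (Q i)] {c i j l : ℤ}
    (φ : (cofree 𝒜 Q c).deg i) (n m : ℕ) (h : i + n = j) (a : 𝒜 n) (hl : j + m + c = l)
    (b : 𝒜 m) :
    cofreeEval m l hl ((cofree 𝒜 Q c).act n h φ a) b =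
      cofreeEval (n + m) l (by push_cast; omega) φ
        ⟨a * b, SetLike.GradedMul.mul_mem a.2 b.2⟩ := rfl

/-- The morphism to a cofree module given by a family of homomorphisms. -/
def cofreeLift {M : GrMod 𝒜} {Q : ℤ → Type u} [∀ i, AddCommGroup (Q i)] {c : ℤ}
    (H : ∀ i j : ℤ, i + c = j → M.deg i →+ Q j) : M ⟶ cofree 𝒜 Q c where
  app i := AddMonoidHom.mk' (fun x p => (H (i + p.1.1) p.1.2 p.2).comp (M.act p.1.1 rfl x))
    (fun x y => by
      refine cofree_ext fun n j hj a => ?_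
      refine Eq.trans (congrArg (H _ _ _) ?_) (map_add (H (i + n) j hj) _ _)
      rw [map_add, AddMonoidHom.add_apply])
  app_act {i j} n h x a := by
    subst h
    refine cofree_ext fun m l hl b => ?_
    have key : ∀ (p q : ℤ) (hp : p + c = l) (hq : q + c = l) (h : i + (n + m : ℕ) = p)
        (h' : i + (n + m : ℕ) = q) (y : 𝒜 (n + m)),
        H p l hp (M.act (n + m) h x y) = H q l hq (M.act (n + m) h' x y) := by
      rintro p q hp hq rfl h' y
      obtain rfl := h'
      rfl
    refine Eq.trans (congrArg (H _ _ _) (M.act_mul _ _ _ _ _ _ _)) ?_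
    exact key _ _ _ _ _ _ _

theorem cofreeEval_lift {M : GrMod 𝒜} {Q : ℤ → Type u} [∀ i, AddCommGroup (Q i)] {c : ℤ}
    (H : ∀ i j : ℤ, i + c = j → M.deg i →+ Q j) (i : ℤ) (x : M.deg i) (n : ℕ) (j : ℤ)
    (hj : i + n + c = j) (a : 𝒜 n) :
    cofreeEval n j hj ((cofreeLift H).app i x) a = H (i + n) j hj (M.act n rfl x a) := rfl

theorem cofreeEval_lift_one {M : GrMod 𝒜} {Q : ℤ → Type u} [∀ i, AddCommGroup (Q i)] {c : ℤ}
    (H : ∀ i j : ℤ, i + c = j → M.deg i →+ Q j) (i : ℤ) (x : M.deg i) (j : ℤ) (hj : i + c = j)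
    (hj' : i + (0 : ℕ) + c = j) :
    cofreeEval 0 j hj' ((cofreeLift H).app i x) ⟨1, SetLike.GradedOne.one_mem⟩ =
      H i j hj x := by
  rw [cofreeEval_lift]
  have key : ∀ (i' : ℤ) (h : i' + c = j) (h' : i + (0 : ℕ) = i'),
      H i' j h (M.act 0 h' x ⟨1, SetLike.GradedOne.one_mem⟩) = H i j hj x := by
    intro i' h h'
    obtain rfl : i = i' := by simpa using h'
    rw [M.act_one]
  exact key _ _ _

/-- Coinduction is right adjoint to forgetting the action: a morphism into `cofree` amounts to
additive maps in each degree, recovered by evaluating at `1`. These extend along a monomorphism one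
degree at a time, since each `Q i` is injective. -/
theorem injective_cofree (Q : ℤ → Type u) [∀ i, AddCommGroup (Q i)] (hQ : ∀ i, IsInjGroup (Q i))
    (c : ℤ) : Injective (cofree 𝒜 Q c) where
  factors {A B} g f _ := by
    have hx : ∀ i j : ℤ, i + c = j → ∃ h : B.deg i →+ Q j, ∀ (hj : i + (0 : ℕ) + c = j)
        (x : A.deg i),
        h (f.app i x) = cofreeEval 0 j hj (g.app i x) ⟨1, SetLike.GradedOne.one_mem⟩ := by
      intro i j h
      have hj : i + (0 : ℕ) + c = j := by simpa using h
      obtain ⟨l, hl⟩ := hQ j _ _ (f.app i) (((cofreeEval 0 j hj).flip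
        ⟨1, SetLike.GradedOne.one_mem⟩).comp (g.app i)) (injective_of_mono f i)
      exact ⟨l, fun _ x => hl x⟩
    choose H hH using hx
    refine ⟨cofreeLift H, ?_⟩
    ext i x
    refine cofree_ext fun n j hj a => ?_
    rw [comp_app, cofreeEval_lift, ← f.app_act, hH _ _ _ (by simpa using hj), g.app_act,
      cofreeEval_act]
    exact cofreeEval_congr _ _ _ _ _ (add_zero n) (mul_one _)

/-- A shift of a cofree module is cofree. -/
def cofreeShiftIso (Q : ℤ → Type u) [∀ i, AddCommGroup (Q i)] (c d : ℤ) :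
    (cofree 𝒜 Q c).shift d ≅ cofree 𝒜 Q (d + c) where
  hom :=
    { app := fun i => AddMonoidHom.mk' (fun φ p => φ ⟨p.1, by have := p.2; omega⟩)
        (fun _ _ => rfl)
      app_act := fun _ _ _ _ => rfl }
  inv :=
    { app := fun i => AddMonoidHom.mk' (fun φ p => φ ⟨p.1, by have := p.2; omega⟩)
        (fun _ _ => rfl)
      app_act := fun _ _ _ _ => rfl }
  hom_inv_id := rfl
  inv_hom_id := rfl

/-- Every graded module embeds in an injective one all of whose shifts are injective, and which
vanishes in nonnegative degrees if the given module does. -/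
theorem exists_cofree_embedding (M : GrMod 𝒜) : ∃ (J : GrMod 𝒜) (f : M ⟶ J),
    (∀ i, Function.Injective (f.app i)) ∧ Injective J ∧ (∀ d, Injective (J.shift d)) ∧
      ((∀ i, 0 ≤ i → Subsingleton (M.deg i)) → ∀ i, 0 ≤ i → Subsingleton (J.deg i)) := by
  choose Q hG ι hι hs hQ using fun i => exists_isInjGroup (M.deg i)
  have hQM : ∀ i j : ℤ, i + 0 = j → ∃ l : M.deg i →+ Q j, Function.Injective l := by
    intro i j h
    obtain rfl : i = j := by simpa using h
    exact ⟨ι i, hι i⟩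
  choose H hH using hQM
  refine ⟨cofree 𝒜 Q 0, cofreeLift H, fun i => ?_, injective_cofree Q hQ 0, fun d => ?_, ?_⟩
  · intro x y hxy
    have := congrArg (fun l => cofreeEval 0 i (by simp) l
      (⟨1, SetLike.GradedOne.one_mem⟩ : 𝒜 0)) hxy
    rw [cofreeEval_lift_one _ _ _ _ (add_zero i), cofreeEval_lift_one _ _ _ _ (add_zero i)] at this
    exact hH _ _ _ this
  · have := injective_cofree (𝒜 := 𝒜) Q hQ (d + 0)
    exact Injective.of_iso (cofreeShiftIso (𝒜 := 𝒜) Q 0 d).symm this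
  · intro hM i hi
    refine ⟨fun φ ψ => cofree_ext fun n j hj a => ?_⟩
    -- Only indices `j = i + n` with `i, n ≥ 0` occur, and `Q j` is trivial there.
    have := hs j (hM j (by omega))
    exact Subsingleton.elim _ _

/-! ### Modules concentrated in negative degrees -/

/-- There are no morphisms from a module in degrees `≥ 0` to one in degrees `< 0`. An injective
module containing `N` can be chosen in degrees `< 0`, so the cokernel also lives there and dimension
shifting applies. -/
theorem ext_subsingleton_of_neg (X : GrMod 𝒜) (hX : ∀ i, i < 0 → Subsingleton (X.deg i)) (j : ℕ) :
    ∀ N : GrMod 𝒜, (∀ i, 0 ≤ i → Subsingleton (N.deg i)) → Subsingleton (Ext X N j) := by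
  have hom : ∀ N : GrMod 𝒜, (∀ i, 0 ≤ i → Subsingleton (N.deg i)) → ∀ f : X ⟶ N, f = 0 := by
    intro N hN f
    ext i x
    rcases lt_or_ge i 0 with hi | hi
    · have := hX i hi
      rw [Subsingleton.elim x 0, map_zero, map_zero]
    · have := hN i hi
      exact Subsingleton.elim _ _
  induction j with
  | zero =>
    intro N hN
    refine subsingleton_of_forall_eq 0 fun x => ?_
    obtain ⟨f, rfl⟩ := Ext.addEquiv₀.symm.surjective x
    rw [hom N hN f, map_zero]
  | succ j ih =>
    intro N hN
    obtain ⟨J, f, hf, hJ, -, hJN⟩ := exists_cofree_embedding N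
    have hS := (isSES_of_injective hf).shortExact
    refine subsingleton_of_forall_eq 0 fun x => ?_
    obtain ⟨y, rfl⟩ := Ext.covariant_sequence_exact₁ X hS x (Ext.eq_zero_of_injective _) rfl
    have := ih (coker f) (fun i hi => by
      have := hJN hN i hi
      exact ((isSES_of_injective hf).surj i).subsingleton)
    have hy : y = 0 := Subsingleton.elim _ _
    rw [hy, Ext.zero_comp]

theorem subsingleton_quot_deg (i : ℤ) (hi : i < 0) : Subsingleton (((self 𝒜).quot 1).deg i) := by
  have : Subsingleton ((self 𝒜).deg i) := by
    cases i with
    | ofNat n => exact absurd hi (by simp)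
    | negSucc n => exact ⟨fun x y => Subtype.ext (x.2.trans y.2.symm)⟩
  exact (surjective_of_epi (quotπ (self 𝒜) 1) i).subsingleton

end GrMod

end NCProj

namespace NCProj

namespace GrMod

variable {k : Type w} {R : Type u} [CommRing k] [Ring R] [Algebra k R]
  {𝒜 : ℕ → Submodule k R} [GradedAlgebra 𝒜]

/-! ### Stability of the torsion theory -/

/-- An essential extension of a torsion module is torsion. -/
theorem isTorsion_of_essential [IsNoetherianRing Rᵐᵒᵖ] {M : GrMod 𝒜}
    {c : ∀ i, AddSubgroup (M.deg i)}
    (hct : ∀ i, ∀ x ∈ c i, M.IsTors x)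
    (hess : ∀ i (x : M.deg i), x ≠ 0 → ∃ (n : ℕ) (a : 𝒜 n),
      M.act n rfl x a ≠ 0 ∧ M.act n rfl x a ∈ c (i + n)) : M.IsTorsion := by
  classical
  intro i x
  -- Multiplication of `x` by the degree `n` component, defined on all of `R` so that it can be
  -- applied to sums of inhomogeneous terms.
  let φ : ∀ n : ℕ, R →+ M.deg (i + n) := fun n => AddMonoidHom.mk'
    (fun b => M.act n rfl x (decompose 𝒜 b n)) (fun a b => by simp)
  have hφ : ∀ (n : ℕ) (a : 𝒜 n), φ n a = M.act n rfl x a := fun n a => by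
    change M.act n rfl x (decompose 𝒜 (a : R) n) = _
    congr 1
    exact Subtype.ext (decompose_of_mem_same 𝒜 a.2)
  -- The homogeneous elements carrying `x` into `c` generate a finitely generated right ideal. Each
  -- generator `z` gives a torsion element `x · z`, so in all large degrees multiples of `x` lying
  -- in `c` are zero.
  let S : Set Rᵐᵒᵖ := {z | ∃ (n : ℕ) (h : z.unop ∈ 𝒜 n), M.act n rfl x ⟨_, h⟩ ∈ c (i + n)}
  obtain ⟨T, hTS, hT⟩ := (Submodule.fg_span_iff_fg_span_finset_subset S).1
    (IsNoetherian.noetherian (Submodule.span Rᵐᵒᵖ S))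
  have key : ∀ z ∈ T, ∃ N : ℕ, ∀ n : ℕ, N ≤ n → ∀ b : R, φ n (z.unop * b) = 0 := by
    intro z hz
    obtain ⟨m, hzm, hm⟩ := hTS hz
    obtain ⟨t, ht⟩ := hct _ _ hm
    refine ⟨m + t, fun n hn b => ?_⟩
    obtain ⟨p, rfl⟩ : ∃ p, n = m + p := ⟨n - m, by omega⟩
    have h1 := ht p (by omega) (decompose 𝒜 b p)
    rw [← act_eq_zero_iff (j := i + (m + p : ℕ)) (by push_cast; omega), M.act_mul] at h1
    rw [← h1]
    change M.act (m + p) rfl x (decompose 𝒜 (z.unop * b) (m + p)) = _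
    congr 1
    exact Subtype.ext (coe_decompose_mul_add_of_left_mem 𝒜 hzm)
  choose! N hN using key
  have hzero : ∀ n : ℕ, T.sup N ≤ n → ∀ a : 𝒜 n, M.act n rfl x a ∈ c (i + n) →
      M.act n rfl x a = 0 := by
    intro n hn a hac
    rw [← hφ]
    have ha : MulOpposite.op (a : R) ∈ Submodule.span Rᵐᵒᵖ (T : Set Rᵐᵒᵖ) := by
      rw [← hT]
      exact Submodule.subset_span ⟨n, a.2, hac⟩
    obtain ⟨e, -, he⟩ := Submodule.mem_span_finset.1 ha
    have h2 : (a : R) = ∑ z ∈ T, z.unop * (e z).unop := by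
      have := congrArg MulOpposite.unop he
      simpa using this.symm
    rw [h2, map_sum]
    refine Finset.sum_eq_zero fun z hz => hN z hz n ?_ _
    exact (Finset.le_sup (f := N) hz).trans hn
  refine ⟨T.sup N, fun n hn a => by_contra fun hne => ?_⟩
  -- A nonzero `x · a` of large degree would have a nonzero multiple in `c`, of still larger degree.
  obtain ⟨m, b, hb, hbc⟩ := hess _ _ hne
  have e : i + ((n + m : ℕ) : ℤ) = i + n + m := by push_cast; omega
  have hmul : M.act m rfl (M.act n rfl x a) b =
      M.act (n + m) e x ⟨a * b, SetLike.GradedMul.mul_mem a.2 b.2⟩ := M.act_mul _ _ _ _ _ _ _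
  rw [hmul] at hb hbc
  refine hb ((act_eq_zero_iff _ _ _).2 (hzero (n + m) (by omega) _ ?_))
  have key : ∀ (j : ℤ) (h : i + ((n + m : ℕ) : ℤ) = j) (y : 𝒜 (n + m)),
      M.act (n + m) h x y ∈ c j → M.act (n + m) rfl x y ∈ c (i + (n + m : ℕ)) := by
    rintro _ rfl y hy
    exact hy
  exact key _ _ _ hbc

/-- The components of the submodule generated by a submodule and a homogeneous element. -/
def adjoinC (M : GrMod 𝒜) {c : ∀ i, AddSubgroup (M.deg i)} {i : ℤ}
    (x : M.deg i) (j : ℤ) : AddSubgroup (M.deg j) where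
  -- In degree `j` only `n = j - i` is possible, so one multiple of `x` suffices; the first
  -- alternative covers `j < i`.
  carrier := {z | z ∈ c j ∨ ∃ (n : ℕ) (h : i + n = j) (a : 𝒜 n), z - M.act n h x a ∈ c j}
  zero_mem' := Or.inl (zero_mem _)
  add_mem' := by
    rintro y z (hy | ⟨n, h, a, hy⟩) (hz | ⟨m, h', b, hz⟩)
    · exact Or.inl (add_mem hy hz)
    · refine Or.inr ⟨m, h', b, ?_⟩
      rw [add_sub_assoc]
      exact add_mem hy hz
    · refine Or.inr ⟨n, h, a, ?_⟩
      rw [add_sub_right_comm]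
      exact add_mem hy hz
    · obtain rfl : n = m := by omega
      refine Or.inr ⟨n, h, a + b, ?_⟩
      rw [map_add, add_sub_add_comm]
      exact add_mem hy hz
  neg_mem' := by
    rintro y (hy | ⟨n, h, a, hy⟩)
    · exact Or.inl (neg_mem hy)
    · refine Or.inr ⟨n, h, -a, ?_⟩
      rw [map_neg, ← neg_sub', neg_mem_iff]
      exact hy

theorem adjoinC_closed (M : GrMod 𝒜) {c : ∀ i, AddSubgroup (M.deg i)} (hc : M.IsClosedUnder c)
    {i : ℤ} (x : M.deg i) : M.IsClosedUnder (M.adjoinC (c := c) x) := by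
  rintro j l n h y a (hy | ⟨m, h', b, hy⟩)
  · exact Or.inl (hc n h y a hy)
  · refine Or.inr ⟨m + n, by push_cast; omega, ⟨b * a, SetLike.GradedMul.mul_mem b.2 a.2⟩, ?_⟩
    rw [← M.act_mul m n h' h]
    have := hc n h _ a hy
    rwa [map_sub, AddMonoidHom.sub_apply] at this

theorem self_mem_adjoinC (M : GrMod 𝒜) (c : ∀ i, AddSubgroup (M.deg i)) {i : ℤ} (x : M.deg i) :
    x ∈ M.adjoinC (c := c) x i :=
  Or.inr ⟨0, by simp, ⟨1, SetLike.GradedOne.one_mem⟩, by rw [M.act_one, sub_self]; exact zero_mem _⟩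

theorem le_adjoinC (M : GrMod 𝒜) (c : ∀ i, AddSubgroup (M.deg i)) {i : ℤ} (x : M.deg i) :
    c ≤ M.adjoinC (c := c) x := fun _ _ hz => Or.inl hz

/-- There is a maximal torsion-free submodule. -/
theorem exists_maximal_torsionFree (M : GrMod 𝒜) :
    ∃ c, Maximal (fun c : ∀ i, AddSubgroup (M.deg i) => M.IsClosedUnder c ∧
      ∀ i, ∀ x ∈ c i, M.IsTors x → x = 0) c := by
  refine zorn_le₀ {c : ∀ i, AddSubgroup (M.deg i) | M.IsClosedUnder c ∧
      ∀ i, ∀ x ∈ c i, M.IsTors x → x = 0} fun s hs hchain => ?_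
  rcases s.eq_empty_or_nonempty with rfl | hne
  · refine ⟨⊥, ⟨fun n h x a hx => ?_, fun i x hx _ => hx⟩, fun z hz => absurd hz (by simp)⟩
    have hx : x = 0 := hx
    rw [hx, map_zero]
    exact zero_mem _
  · have hmem : ∀ i (x : M.deg i), x ∈ (⨆ c : s, c.1) i ↔ ∃ c ∈ s, x ∈ c i := by
      intro i x
      have : Nonempty s := hne.to_subtype
      rw [iSup_apply, AddSubgroup.mem_iSup_of_directed]
      · simp
      · rintro ⟨a, ha⟩ ⟨b, hb⟩
        rcases hchain.total ha hb with h | h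
        · exact ⟨⟨b, hb⟩, h i, le_rfl⟩
        · exact ⟨⟨a, ha⟩, le_rfl, h i⟩
    refine ⟨⨆ c : s, c.1, ⟨fun n h x a hx => ?_, fun i x hx ht => ?_⟩, fun c hc =>
      le_iSup (fun c : s => c.1) ⟨c, hc⟩⟩
    · obtain ⟨c, hcs, hc⟩ := (hmem _ _).1 hx
      exact (hmem _ _).2 ⟨c, hcs, (hs hcs).1 n h x a hc⟩
    · obtain ⟨c, hcs, hc⟩ := (hmem _ _).1 hx
      exact (hs hcs).2 i x hc ht

/-- The torsion submodule of an injective module is a direct summand. -/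
theorem exists_tors_retraction [IsNoetherianRing Rᵐᵒᵖ] (J : GrMod 𝒜) [Injective J] :
    ∃ r : J ⟶ J.tors, J.torsι ≫ r = 𝟙 _ := by
  obtain ⟨c, ⟨hc, hct⟩, hmax⟩ := exists_maximal_torsionFree J
  have hS := isSES_of_injective (J.subι_injective c hc)
  have h0 : ∀ i (x : J.deg i), (cokerπ (J.subι c hc)).app i x = 0 ↔ x ∈ c i := fun i x =>
    (hS.exact i x).trans ⟨fun ⟨y, hy⟩ => hy ▸ y.2, fun h => ⟨⟨x, h⟩, rfl⟩⟩
  -- `J / c` is an essential extension of the image of the torsion submodule: for `x ∉ c`,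
  -- maximality puts a nonzero torsion element `z` in `c + xR`, and modulo `c` it becomes a nonzero
  -- multiple of `x`.
  have htor : (coker (J.subι c hc)).IsTorsion := by
    refine isTorsion_of_essential
      (c := fun i => (J.torsC i).map ((cokerπ (J.subι c hc)).app i)) ?_ ?_
    · rintro i _ ⟨x, hx, rfl⟩
      exact IsTors.map _ hx
    · intro i y hy
      obtain ⟨x, rfl⟩ := hS.surj i y
      have hx : x ∉ c i := fun h => hy ((h0 _ _).2 h)
      have hnot : ¬ ∀ j, ∀ z ∈ J.adjoinC (c := c) x j, J.IsTors z → z = 0 := fun h =>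
        hx (hmax ⟨J.adjoinC_closed hc x, h⟩ (J.le_adjoinC c x) i (J.self_mem_adjoinC c x))
      push Not at hnot
      obtain ⟨j, z, hz | ⟨n, rfl, a, hz⟩, hzt, hz0⟩ := hnot
      · exact absurd (hct j z hz hzt) hz0
      · have hzx : (cokerπ (J.subι c hc)).app _ z =
            (coker (J.subι c hc)).act n rfl ((cokerπ (J.subι c hc)).app i x) a := by
          rw [← Hom.app_act, ← sub_eq_zero, ← map_sub]
          exact (h0 _ _).2 hz
        refine ⟨n, a, ?_, ?_⟩
        · rw [← hzx]
          exact fun h => hz0 (hct _ z ((h0 _ _).1 h) hzt)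
        · rw [← hzx]
          exact ⟨z, hzt, rfl⟩
  have hmono : Mono (J.torsι ≫ cokerπ (J.subι c hc)) := by
    refine mono_of_injective fun i => (injective_iff_map_eq_zero _).2 fun x hx => ?_
    exact Subtype.ext (hct i x.1 ((h0 _ _).1 hx) x.2)
  -- The torsion submodule meets `c` trivially, so it embeds in `J / c`. Extending its inclusion
  -- into `J` over `J / c` gives a map with torsion image, that is, a retraction.
  obtain ⟨l, hl⟩ := Injective.factors J.torsι (J.torsι ≫ cokerπ (J.subι c hc))
  refine ⟨subLift J.torsC_closed (cokerπ (J.subι c hc) ≫ l) (fun i x =>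
    IsTors.map l (htor i _)), ?_⟩
  ext i x
  exact Subtype.ext (congrArg (fun t => Hom.app t i x) hl)

/-- A torsion-free module embeds in a torsion-free module all of whose shifts are injective. -/
theorem exists_torsionFree_embedding [IsNoetherianRing Rᵐᵒᵖ] (M : GrMod 𝒜)
    (hM : IsTorsionFree 𝒜 M) : ∃ (I : GrMod 𝒜) (f : M ⟶ I),
    (∀ i, Function.Injective (f.app i)) ∧ IsTorsionFree 𝒜 I ∧ ∀ d, Injective (I.shift d) := by
  obtain ⟨J, f, hf, hJ, hJd, -⟩ := exists_cofree_embedding M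
  obtain ⟨r, hr⟩ := exists_tors_retraction J
  refine ⟨J.modTors, f ≫ J.modTorsπ, fun i => (injective_iff_map_eq_zero _).2 fun x hx => ?_,
    isTorsionFree_modTors J, fun d => ?_⟩
  · obtain ⟨y, hy⟩ := (J.isSES_tors.exact i _).1 hx
    refine hM i x (IsTors.of_map f hf ?_)
    rw [← hy]
    exact y.2
  -- The idempotent complementary to `r ≫ J.torsι` descends to a section of `J.modTorsπ`; thus
  -- `J.modTors` is a summand of `J`, and each shift is a summand of an injective module.
  · obtain ⟨s, hs⟩ := J.isSES_tors.exists_desc (𝟙 J - r ≫ J.torsι) (by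
      rw [Preadditive.comp_sub, Category.comp_id, ← Category.assoc, hr, Category.id_comp, sub_self])
    have hsπ : s ≫ J.modTorsπ = 𝟙 _ := by
      have := epi_of_surjective J.isSES_tors.surj
      rw [← cancel_epi J.modTorsπ, ← Category.assoc, hs, Preadditive.sub_comp, Category.assoc,
        J.isSES_tors.comp_eq_zero, comp_zero, sub_zero, Category.id_comp, Category.comp_id]
    refine ⟨fun {A B} g m _ => ?_⟩
    obtain ⟨l, hl⟩ := (hJd d).factors (g ≫ shiftMap s d) m
    refine ⟨l ≫ shiftMap J.modTorsπ d, ?_⟩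
    rw [← Category.assoc, hl, Category.assoc, shiftMap_comp, hsπ, shiftMap_id, Category.comp_id]

end GrMod

end NCProj

/-! ### Propagation of Ext finiteness along exact sequences. -/

namespace NCProj

/-! ### Finiteness of Ext modules in exact sequences -/

section

variable {C : Type*} [Category C] [Abelian C] [HasExt.{u + 1} C] {S : Type*} [Ring S] {X : C}

/-- `Ext^j(X, Y)` as a right module over a ring acting on `X`. -/
def ExtMod (_ : S →+* End X) (Y : C) (j : ℕ) : Type (u + 1) := Ext X Y j

noncomputable instance (ρ : S →+* End X) (Y : C) (j : ℕ) : AddCommGroup (ExtMod ρ Y j) :=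
  inferInstanceAs (AddCommGroup (Ext X Y j))

noncomputable instance (ρ : S →+* End X) (Y : C) (j : ℕ) : Module Sᵐᵒᵖ (ExtMod ρ Y j) :=
  extModule ρ Y j

/-- Composition with an extension class, as a linear map. -/
noncomputable def extPost (ρ : S →+* End X) {Y Z : C} {j n l : ℕ} (β : Ext Y Z n) (h : j + n = l) :
    ExtMod ρ Y j →ₗ[Sᵐᵒᵖ] ExtMod ρ Z l where
  toFun x := Ext.comp x β h
  map_add' x y := Ext.add_comp x y β h
  map_smul' s x := Ext.comp_assoc (Ext.mk₀ (ρ s.unop)) x β (zero_add j) h (by omega)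

/-- Postcomposition with a morphism, as a linear map. -/
noncomputable abbrev extMap (ρ : S →+* End X) {Y Z : C} (g : Y ⟶ Z) (j : ℕ) :
    ExtMod ρ Y j →ₗ[Sᵐᵒᵖ] ExtMod ρ Z j := extPost ρ (Ext.mk₀ g) (add_zero j)

theorem extMap_injective_of_mono (ρ : S →+* End X) {Y Z : C} (g : Y ⟶ Z) [Mono g] :
    Function.Injective (extMap ρ g 0) :=
  Ext.postcomp_mk₀_injective_of_mono X g

/-- The isomorphism on `Ext` induced by an isomorphism. -/
noncomputable def extIso (ρ : S →+* End X) {Y Z : C} (e : Y ≅ Z) (j : ℕ) :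
    ExtMod ρ Y j ≃ₗ[Sᵐᵒᵖ] ExtMod ρ Z j where
  __ := extMap ρ e.hom j
  invFun := extMap ρ e.inv j
  left_inv x := by
    refine (Ext.comp_assoc_of_second_deg_zero (X := X) x _ (Ext.mk₀ e.inv) (add_zero j)).trans ?_
    rw [Ext.mk₀_comp_mk₀, e.hom_inv_id]
    exact Ext.comp_mk₀_id _
  right_inv x := by
    refine (Ext.comp_assoc_of_second_deg_zero (X := X) x _ (Ext.mk₀ e.hom) (add_zero j)).trans ?_
    rw [Ext.mk₀_comp_mk₀, e.inv_hom_id]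
    exact Ext.comp_mk₀_id _

theorem finite_of_exact {A : Type*} [Ring A] [IsNoetherianRing A] {M N P : Type*} [AddCommGroup M]
    [AddCommGroup N] [AddCommGroup P] [Module A M] [Module A N] [Module A P] [Module.Finite A M]
    [Module.Finite A P] (f : M →ₗ[A] N) (g : N →ₗ[A] P) (h : ∀ x, g x = 0 → ∃ y, f y = x) :
    Module.Finite A N := by
  have hk : IsNoetherian A (LinearMap.ker g) := by
    have : LinearMap.ker g ≤ LinearMap.range f := fun x hx => h x hx
    exact isNoetherian_of_le this
  have : IsNoetherian A N := isNoetherian_of_range_eq_ker (LinearMap.ker g).subtype g (by simp)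
  infer_instance

theorem finite_ext₂ [IsNoetherianRing Sᵐᵒᵖ] (ρ : S →+* End X) {T : ShortComplex C}
    (hT : T.ShortExact) (j : ℕ) [Module.Finite Sᵐᵒᵖ (ExtMod ρ T.X₁ j)]
    [Module.Finite Sᵐᵒᵖ (ExtMod ρ T.X₃ j)] : Module.Finite Sᵐᵒᵖ (ExtMod ρ T.X₂ j) :=
  finite_of_exact (extMap ρ T.f j) (extMap ρ T.g j) (Ext.covariant_sequence_exact₂ X hT)

theorem finite_ext₃ [IsNoetherianRing Sᵐᵒᵖ] (ρ : S →+* End X) {T : ShortComplex C}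
    (hT : T.ShortExact) (j : ℕ) [Module.Finite Sᵐᵒᵖ (ExtMod ρ T.X₂ j)]
    [Module.Finite Sᵐᵒᵖ (ExtMod ρ T.X₁ (j + 1))] : Module.Finite Sᵐᵒᵖ (ExtMod ρ T.X₃ j) :=
  finite_of_exact (extMap ρ T.g j) (extPost ρ hT.extClass rfl)
    (fun x => Ext.covariant_sequence_exact₃ X hT x rfl)

theorem subsingleton_ext₂ {T : ShortComplex C} (hT : T.ShortExact) (X : C) (j : ℕ) [Subsingleton (Ext X T.X₁ j)]
    [Subsingleton (Ext X T.X₃ j)] : Subsingleton (Ext X T.X₂ j) := by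
  refine subsingleton_of_forall_eq 0 fun x => ?_
  obtain ⟨y, rfl⟩ := Ext.covariant_sequence_exact₂ X hT x (Subsingleton.elim _ _)
  rw [Subsingleton.elim y 0, Ext.zero_comp]

theorem subsingleton_ext₃ {T : ShortComplex C} (hT : T.ShortExact) (X : C) (j : ℕ) [Subsingleton (Ext X T.X₂ j)]
    [Subsingleton (Ext X T.X₁ (j + 1))] : Subsingleton (Ext X T.X₃ j) := by
  refine subsingleton_of_forall_eq 0 fun x => ?_
  obtain ⟨y, rfl⟩ := Ext.covariant_sequence_exact₃ X hT x rfl (Subsingleton.elim _ _)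
  rw [Subsingleton.elim y 0, Ext.zero_comp]

theorem mk₀_comp_extClass_eq_zero {T : ShortComplex C} (hT : T.ShortExact) (l : X ⟶ T.X₂) :
    (Ext.mk₀ (l ≫ T.g)).comp hT.extClass (zero_add 1) = 0 := by
  rw [← Ext.mk₀_comp_mk₀, Ext.comp_assoc_of_second_deg_zero, hT.comp_extClass, Ext.comp_zero]

end

/-! ### Modules with finite graded Ext groups from `R / R_{≥ 1}` -/

variable {k : Type w} {R : Type u} [CommRing k] [Ring R] [Algebra k R]
  {𝒜 : ℕ → Submodule k R} [GradedAlgebra 𝒜]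

open GrMod

variable (𝒜) in
theorem isNoetherianRing_zero [IsNoetherianRing Rᵐᵒᵖ] : IsNoetherianRing (𝒜 0)ᵐᵒᵖ :=
  isNoetherianRing_of_surjective Rᵐᵒᵖ (𝒜 0)ᵐᵒᵖ (GradedRing.projZeroRingHom' 𝒜).op fun x => by
    obtain ⟨y, hy⟩ := GradedRing.projZeroRingHom'_surjective 𝒜 x.unop
    exact ⟨MulOpposite.op y, MulOpposite.unop_injective hy⟩

variable (𝒜) in
/-- `Ext^j(R / R_{≥ 1}, M[d])` is finite over `R_0` for all `j` and `d`, and for every `j` it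
vanishes for large `d`. -/
structure HasFiniteExt (M : GrMod 𝒜) : Prop where
  finite (j : ℕ) (d : ℤ) : Module.Finite (𝒜 0)ᵐᵒᵖ (ExtMod (leftMulQuot 𝒜 1) (M.shift d) j)
  vanish (j : ℕ) : ∃ d₀ : ℤ, ∀ d, d₀ ≤ d → Subsingleton (Ext ((self 𝒜).quot 1) (M.shift d) j)

/-- Finitely many elements of a direct sum have finitely many nonzero components, so a finitely
generated direct sum has finite summands, and almost all of them vanish. -/
theorem Chi.hasFiniteExt (hχ : Chi 𝒜) {M : GrMod 𝒜} (hM : M.IsFG) : HasFiniteExt 𝒜 M where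
  finite j d := by
    have := hχ j M hM j le_rfl
    exact Module.Finite.of_surjective
      (DirectSum.component (𝒜 0)ᵐᵒᵖ ℤ (fun d => GrExtRes M j d) d)
      (fun x => ⟨DirectSum.of _ d x, DirectSum.of_eq_same _ _⟩)
  vanish j := by
    classical
    obtain ⟨T, hT⟩ := (hχ j M hM j le_rfl).fg_top
    obtain ⟨d₀, hd₀⟩ := (T.sup DFinsupp.support).exists_le
    refine ⟨d₀ + 1, fun d hd => subsingleton_of_forall_eq 0 fun x => ?_⟩
    let π := DirectSum.component (𝒜 0)ᵐᵒᵖ ℤ (fun d => GrExtRes M j d) d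
    have hπ : (⊤ : Submodule _ _) ≤ LinearMap.ker π := by
      rw [← hT, Submodule.span_le]
      intro y hy
      by_contra hne
      have h1 : d ∈ T.sup DFinsupp.support :=
        Finset.mem_sup.2 ⟨y, hy, DFinsupp.mem_support_iff.2 hne⟩
      have := hd₀ d h1
      omega
    exact (DirectSum.of_eq_same (β := fun d => GrExtRes M j d) d x).symm.trans
      (hπ (Submodule.mem_top (x := DirectSum.of (fun d => GrExtRes M j d) d x)))

/-- Finiteness passes to the middle term of a short exact sequence. -/
theorem HasFiniteExt.middle [IsNoetherianRing Rᵐᵒᵖ] {A B C : GrMod 𝒜} {f : A ⟶ B} {g : B ⟶ C}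
    (h : IsSES f g) (hA : HasFiniteExt 𝒜 A) (hC : HasFiniteExt 𝒜 C) : HasFiniteExt 𝒜 B where
  finite j d := by
    have := isNoetherianRing_zero 𝒜
    have := hA.finite j d
    have := hC.finite j d
    exact finite_ext₂ (leftMulQuot 𝒜 1) (h.shift d).shortExact j
  vanish j := by
    obtain ⟨a, ha⟩ := hA.vanish j
    obtain ⟨c, hc⟩ := hC.vanish j
    refine ⟨max a c, fun d hd => ?_⟩
    have := ha d (by omega)
    have := hc d (by omega)
    exact subsingleton_ext₂ (h.shift d).shortExact _ j

/-- Finiteness passes to the quotient of a short exact sequence. -/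
theorem HasFiniteExt.quotient [IsNoetherianRing Rᵐᵒᵖ] {A B C : GrMod 𝒜} {f : A ⟶ B} {g : B ⟶ C}
    (h : IsSES f g) (hA : HasFiniteExt 𝒜 A) (hB : HasFiniteExt 𝒜 B) : HasFiniteExt 𝒜 C where
  finite j d := by
    have := isNoetherianRing_zero 𝒜
    have := hA.finite (j + 1) d
    have := hB.finite j d
    exact finite_ext₃ (leftMulQuot 𝒜 1) (h.shift d).shortExact j
  vanish j := by
    obtain ⟨a, ha⟩ := hA.vanish (j + 1)
    obtain ⟨b, hb⟩ := hB.vanish j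
    refine ⟨max a b, fun d hd => ?_⟩
    have := ha d (by omega)
    have := hb d (by omega)
    exact subsingleton_ext₃ (h.shift d).shortExact _ j

theorem hom_quot_eq_zero {M : GrMod 𝒜} (hM : IsTorsionFree 𝒜 M) (f : (self 𝒜).quot 1 ⟶ M) :
    f = 0 :=
  quot_hom_eq_zero f (hM _ _ ⟨1, quot_hom_act f⟩)

/-- Finiteness for the cosyzygies of a torsion-free module. -/
theorem HasFiniteExt.cosyzygy [IsNoetherianRing Rᵐᵒᵖ] {A B C : GrMod 𝒜} {f : A ⟶ B} {g : B ⟶ C}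
    (h : IsSES f g) (hA : HasFiniteExt 𝒜 A) (hB : IsTorsionFree 𝒜 B)
    (hI : ∀ d, Injective (B.shift d)) : HasFiniteExt 𝒜 C := by
  -- Ext from $R/R_{\ge 1}$ to `B.shift d` is zero: in degree `0` by torsion-freeness, in higher
  -- degrees by injectivity. Hence `C` inherits finiteness from `A` one Ext degree higher.
  have hs : ∀ j d, Subsingleton (Ext ((self 𝒜).quot 1) (B.shift d) j) := fun j d => by
    cases j with
    | zero =>
      refine subsingleton_of_forall_eq 0 fun x => ?_
      obtain ⟨l, rfl⟩ := Ext.addEquiv₀.symm.surjective x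
      rw [hom_quot_eq_zero (hB.shift d) l, map_zero]
    | succ j =>
      have := hI d
      exact Ext.subsingleton_of_injective _ _ j
  refine HasFiniteExt.quotient h hA ⟨fun j d => ?_, fun j => ⟨0, fun d _ => hs j d⟩⟩
  have : Subsingleton (ExtMod (leftMulQuot 𝒜 1) (B.shift d) j) := hs j d
  infer_instance

end NCProj

/-! ### Generators, and torsion submodules under $\chi$. -/

namespace NCProj

variable {k : Type w} {R : Type u} [CommRing k] [Ring R] [Algebra k R]
  {𝒜 : ℕ → Submodule k R} [GradedAlgebra 𝒜]

namespace GrMod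

/-! ### Generation -/

/-- The components of the submodule generated by a set of homogeneous elements. -/
def gen (M : GrMod 𝒜) (G : Set (Σ i, M.deg i)) (j : ℤ) : AddSubgroup (M.deg j) :=
  AddSubgroup.closure {y | ∃ p ∈ G, ∃ (n : ℕ) (h : p.1 + n = j) (a : 𝒜 n), M.act n h p.2 a = y}

theorem act_mem_gen {M : GrMod 𝒜} {G : Set (Σ i, M.deg i)} {i j : ℤ} {x : M.deg i}
    (hx : ⟨i, x⟩ ∈ G) (n : ℕ) (h : i + n = j) (a : 𝒜 n) : M.act n h x a ∈ M.gen G j :=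
  AddSubgroup.subset_closure ⟨_, hx, n, h, a, rfl⟩

theorem mem_gen {M : GrMod 𝒜} {G : Set (Σ i, M.deg i)} {i : ℤ} {x : M.deg i}
    (hx : ⟨i, x⟩ ∈ G) : x ∈ M.gen G i := by
  have := act_mem_gen (j := i) hx 0 (by simp) ⟨1, SetLike.GradedOne.one_mem⟩
  rwa [M.act_one] at this

theorem gen_le {M : GrMod 𝒜} {G : Set (Σ i, M.deg i)} {c : ∀ i, AddSubgroup (M.deg i)}
    (hc : M.IsClosedUnder c) (h : ∀ p ∈ G, p.2 ∈ c p.1) (j : ℤ) : M.gen G j ≤ c j := by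
  refine (AddSubgroup.closure_le _).2 ?_
  rintro _ ⟨p, hp, n, hn, a, rfl⟩
  exact hc n hn p.2 a (h p hp)

theorem gen_closed (M : GrMod 𝒜) (G : Set (Σ i, M.deg i)) : M.IsClosedUnder (M.gen G) := by
  intro i j n h x a hx
  induction hx using AddSubgroup.closure_induction with
  | mem x hx =>
    obtain ⟨p, hp, m, hm, b, rfl⟩ := hx
    rw [M.act_mul]
    exact act_mem_gen hp _ _ _
  | zero => simp
  | add x y _ _ hx hy =>
    rw [map_add, AddMonoidHom.add_apply]
    exact add_mem hx hy
  | neg x _ hx =>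
    rw [map_neg, AddMonoidHom.neg_apply]
    exact neg_mem hx

theorem gen_mono (M : GrMod 𝒜) {G G' : Set (Σ i, M.deg i)} (h : G ⊆ G') : M.gen G ≤ M.gen G' :=
  fun j => gen_le (M.gen_closed G') (fun _ hp => mem_gen (h hp)) j

theorem app_mem_gen {M N : GrMod 𝒜} (f : M ⟶ N) {G : Set (Σ i, M.deg i)}
    {G' : Set (Σ i, N.deg i)} (h : ∀ p ∈ G, f.app p.1 p.2 ∈ N.gen G' p.1) {j : ℤ} {x : M.deg j}
    (hx : x ∈ M.gen G j) : f.app j x ∈ N.gen G' j :=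
  gen_le (c := fun i => (N.gen G' i).comap (f.app i)) (fun n e x a hx => by
    change f.app _ _ ∈ N.gen G' _
    rw [f.app_act]
    exact N.gen_closed G' n e _ a hx) h j hx

theorem isFG_iff {M : GrMod 𝒜} :
    M.IsFG ↔ ∃ G : Set (Σ i, M.deg i), G.Finite ∧ ∀ j, M.gen G j = ⊤ := by
  have key : ∀ (r : ℕ) (g : Fin r → Σ i, M.deg i) (j : ℤ), M.gen (Set.range g) j =
      AddSubgroup.closure {y : M.deg j | ∃ (t : Fin r) (n : ℕ) (h : (g t).1 + n = j) (a : 𝒜 n),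
        M.act n h (g t).2 a = y} := fun r g j => by
    simp only [gen, Set.exists_range_iff]
  constructor
  · rintro ⟨r, e, g, h⟩
    exact ⟨Set.range fun t => ⟨e t, g t⟩, Set.finite_range _, fun j => (key r _ j).trans (h j)⟩
  · rintro ⟨G, hG, h⟩
    obtain ⟨r, g, -, rfl⟩ := hG.fin_param
    exact ⟨r, fun t => (g t).1, fun t => (g t).2, fun j => (key r g j).symm.trans (h j)⟩

theorem IsSES.isFG {A B C : GrMod 𝒜} {f : A ⟶ B} {g : B ⟶ C} (h : IsSES f g) (hA : A.IsFG)
    (hC : C.IsFG) : B.IsFG := by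
  obtain ⟨G, hG, hGt⟩ := isFG_iff.1 hA
  obtain ⟨G', hG', hGt'⟩ := isFG_iff.1 hC
  choose s hs using h.surj
  let E : Set (Σ i, B.deg i) := (fun p => ⟨p.1, f.app p.1 p.2⟩) '' G ∪
    (fun p => ⟨p.1, s p.1 p.2⟩) '' G'
  refine isFG_iff.2 ⟨E, (hG.image _).union (hG'.image _), fun j => ?_⟩
  have hf : ∀ i (y : A.deg i), f.app i y ∈ B.gen E i := fun i y =>
    app_mem_gen f (fun p hp => mem_gen (Or.inl ⟨p, hp, rfl⟩)) (by rw [hGt i]; trivial)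
  have hg : ∀ i (z : C.deg i), ∃ x ∈ B.gen E i, g.app i x = z := by
    intro i z
    have hz : z ∈ (B.gen E i).map (g.app i) :=
      gen_le (c := fun i => (B.gen E i).map (g.app i)) (by
        rintro i j n e _ a ⟨x, hx, rfl⟩
        exact ⟨_, B.gen_closed E n e x a hx, g.app_act n e x a⟩)
        (fun p hp => ⟨s p.1 p.2, mem_gen (Or.inr ⟨p, hp, rfl⟩), hs _ _⟩) i
        (by rw [hGt' i]; trivial : z ∈ C.gen G' i)
    exact hz
  refine (AddSubgroup.eq_top_iff' _).2 fun x => ?_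
  obtain ⟨y, hy, hyx⟩ := hg j (g.app j x)
  obtain ⟨z, hz⟩ := (h.exact j (x - y)).1 (by rw [map_sub, hyx, sub_self])
  rw [← sub_add_cancel x y, ← hz]
  exact add_mem (hf j z) hy

theorem isFG_of_subsingleton {M : GrMod 𝒜} (h : ∀ i, Subsingleton (M.deg i)) : M.IsFG :=
  isFG_iff.2 ⟨∅, Set.finite_empty, fun j => by
    have := h j
    exact (AddSubgroup.eq_top_iff' _).2 fun x => by
      rw [Subsingleton.elim x 0]; exact zero_mem _⟩

end GrMod

open GrMod

/-! ### Evaluation at `1` -/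

/-- `Hom(R, M) = M_0`. -/
noncomputable def evalOne (M : GrMod 𝒜) : ExtMod (leftMul 𝒜) M 0 →+ M.deg 0 :=
  AddMonoidHom.mk' (fun x => Hom.app (Ext.addEquiv₀ (show Ext (self 𝒜) M 0 from x)) 0 selfOne)
    (fun x y => congrArg (fun l : self 𝒜 ⟶ M => l.app 0 selfOne)
      (Ext.addEquiv₀.map_add (show Ext (self 𝒜) M 0 from x) y))

theorem evalOne_mk₀ {M : GrMod 𝒜} (f : self 𝒜 ⟶ M) :
    evalOne M (Ext.mk₀ f) = f.app 0 selfOne :=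
  congrArg (fun l : self 𝒜 ⟶ M => l.app 0 selfOne) (Ext.addEquiv₀.apply_symm_apply f)

theorem evalOne_injective (M : GrMod 𝒜) : Function.Injective (evalOne M) := by
  intro x y h
  obtain ⟨f, rfl⟩ := (Ext.mk₀_bijective _ _).2 x
  obtain ⟨g, rfl⟩ := (Ext.mk₀_bijective _ _).2 y
  erw [evalOne_mk₀, evalOne_mk₀] at h
  rw [self_hom_ext h]

theorem evalOne_smul {M : GrMod 𝒜} (s : (𝒜 0)ᵐᵒᵖ) (x : ExtMod (leftMul 𝒜) M 0) :
    evalOne M (s • x) = M.act 0 (by simp) (evalOne M x) s.unop := by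
  obtain ⟨f, rfl⟩ := (Ext.mk₀_bijective _ _).2 x
  have h : s • (show ExtMod (leftMul 𝒜) M 0 from Ext.mk₀ f) = Ext.mk₀ (leftMul 𝒜 s.unop ≫ f) :=
    Ext.mk₀_comp_mk₀ _ _
  refine (congrArg _ h).trans ((evalOne_mk₀ _).trans ?_)
  rw [comp_app]
  refine Eq.trans ?_ (congrArg (fun y => M.act 0 _ y s.unop) (evalOne_mk₀ f).symm)
  rw [← f.app_act]
  congr 1
  exact Subtype.ext ((mul_one (s.unop : R)).trans (one_mul (s.unop : R)).symm)

theorem evalOne_mem_closure {M : GrMod 𝒜} (T : Set (ExtMod (leftMul 𝒜) M 0))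
    {x : ExtMod (leftMul 𝒜) M 0} (hx : x ∈ Submodule.span (𝒜 0)ᵐᵒᵖ T) :
    evalOne M x ∈ M.gen ((fun t => ⟨0, evalOne M t⟩) '' T) 0 := by
  induction hx using Submodule.span_induction with
  | mem x hx => exact mem_gen ⟨x, hx, rfl⟩
  | zero => rw [map_zero]; exact zero_mem _
  | add x y _ _ hx hy => rw [map_add]; exact add_mem hx hy
  | smul s x _ hx => rw [evalOne_smul]; exact M.gen_closed _ _ _ _ _ hx

/-- Restriction along `R ⟶ R / R_{≥ 1}`. -/
noncomputable def extQuotToSelf (M : GrMod 𝒜) :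
    ExtMod (leftMulQuot 𝒜 1) M 0 →ₗ[(𝒜 0)ᵐᵒᵖ] ExtMod (leftMul 𝒜) M 0 where
  toFun x := (Ext.mk₀ ((self 𝒜).quotπ 1)).comp (show Ext _ M 0 from x) (zero_add 0)
  map_add' x y := Ext.comp_add _ _ _ _
  map_smul' s x := by
    refine (Ext.mk₀_comp_mk₀_assoc ((self 𝒜).quotπ 1) (quotMap (leftMul 𝒜 s.unop) 1)
      (show Ext _ M 0 from x)).trans ?_
    rw [quotπ_quotMap]
    exact (Ext.mk₀_comp_mk₀_assoc _ _ _).symm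

theorem exists_evalOne_extQuotToSelf {M : GrMod 𝒜} (x : M.deg 0)
    (hx : ∀ n : ℕ, 1 ≤ n → ∀ a : 𝒜 n, M.act n rfl x a = 0) :
    ∃ y, evalOne M (extQuotToSelf M y) = x := by
  obtain ⟨f, hf⟩ := exists_quot_hom x hx
  refine ⟨Ext.mk₀ f, ?_⟩
  rw [← hf, ← evalOne_mk₀]
  exact congrArg _ (Ext.mk₀_comp_mk₀ _ _)

/-! ### The torsion submodule of a module with finite Ext groups -/

/-- A bounded above module with finitely generated truncations. -/
structure IsCofinite (M : GrMod 𝒜) : Prop where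
  bounded : ∃ d₀ : ℤ, ∀ i, d₀ ≤ i → Subsingleton (M.deg i)
  isFG (d : ℤ) : (M.trunc d).IsFG

/-- Degree `d` elements killed by $R_{\ge 1}$ are morphisms $R/R_{\ge 1} \to M[d]$, so there are no
nonzero ones for large `d`. If `x` is killed by $R_{\ge s+1}$, its multiples by positive-degree
elements are killed by $R_{\ge s}$, and induction on `s` reduces to that case. -/
theorem HasFiniteExt.exists_tors_eq_zero {M : GrMod 𝒜} (hM : HasFiniteExt 𝒜 M) :
    ∃ d₀ : ℤ, ∀ i, d₀ ≤ i → ∀ x : M.deg i, M.IsTors x → x = 0 := by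
  obtain ⟨d₀, hd₀⟩ := hM.vanish 0
  have socle : ∀ i, d₀ ≤ i → ∀ x : M.deg i, (∀ n : ℕ, 1 ≤ n → ∀ a : 𝒜 n, M.act n rfl x a = 0) →
      x = 0 := by
    intro i hi x hx
    obtain ⟨d, rfl⟩ : ∃ d, i = 0 + d := ⟨i, by simp⟩
    have hs := hd₀ d (by simpa using hi)
    obtain ⟨f, hf⟩ := exists_quot_hom (M := M.shift d) x
      fun n hn a => (act_eq_zero_iff (M := M) (by omega) x a).2 (hx n hn a)
    have hf0 : f = 0 := (Ext.mk₀_eq_zero_iff f).1 (Subsingleton.elim _ _)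
    rw [← hf, hf0, comp_zero]
    rfl
  have key : ∀ (s : ℕ) (i : ℤ), d₀ ≤ i → ∀ x : M.deg i,
      (∀ n : ℕ, s ≤ n → ∀ a : 𝒜 n, M.act n rfl x a = 0) → x = 0 := by
    intro s
    induction s with
    | zero =>
      intro i _ x hx
      rw [← M.act_one x, act_eq_zero_iff]
      exact hx 0 le_rfl _
    | succ s ih =>
      intro i hi x hx
      refine socle i hi x fun m hm a => ih _ (by omega) _ fun n hn b => ?_
      rw [M.act_mul, act_eq_zero_iff]
      exact hx _ (by omega) _
  exact ⟨d₀, fun i hi x ⟨s, hs⟩ => key s i hi x hs⟩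

/-- The inclusion `M_{≥ d + 1} ⟶ M_{≥ d}`. -/
def truncSucc (M : GrMod 𝒜) (d : ℤ) : M.trunc (d + 1) ⟶ M.trunc d where
  app i := AddMonoidHom.mk' (fun x => ⟨x.1, fun h => x.2 (by omega)⟩) (fun _ _ => rfl)
  app_act _ _ _ _ := rfl

theorem truncSucc_injective (M : GrMod 𝒜) (d i : ℤ) :
    Function.Injective ((truncSucc M d).app i) :=
  fun x y h => Subtype.ext (congrArg (fun z : (M.trunc d).deg i => z.1) h : x.1 = y.1)

theorem truncι_injective (M : GrMod 𝒜) (d i : ℤ) :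
    Function.Injective ((M.truncι d).app i) := Subtype.val_injective

/-- The quotient $L_{\ge d}/L_{\ge d+1}$ lives in degree `d`, so it is killed by $R_{\ge 1}$ and is
seen entirely by $\mathrm{Hom}(R/R_{\ge 1}, -[d])$. The long exact sequence places this Hom between
$\mathrm{Hom}(R/R_{\ge 1}, L_{\ge d}[d])$ and $\mathrm{Ext}^1(R/R_{\ge 1}, L_{\ge d+1}[d])$; the
latter is finite by $\chi$. -/
theorem isFG_trunc_of_succ [IsNoetherianRing Rᵐᵒᵖ] (hχ : Chi 𝒜) {L : GrMod 𝒜} (d : ℤ)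
    (hL : Module.Finite (𝒜 0)ᵐᵒᵖ (ExtMod (leftMulQuot 𝒜 1) (L.shift d) 0))
    (h : (L.trunc (d + 1)).IsFG) : (L.trunc d).IsFG := by
  have := isNoetherianRing_zero 𝒜
  have hS := isSES_of_injective (truncSucc_injective L d)
  refine hS.isFG h ?_
  have hQ : ∀ i, i ≠ 0 + d → Subsingleton ((coker (truncSucc L d)).deg i) := by
    intro i hi
    refine subsingleton_of_forall_eq 0 fun x => ?_
    obtain ⟨x, rfl⟩ := hS.surj i x
    exact (hS.exact i x).2 ⟨⟨x.1, fun h => x.2 (by omega)⟩, rfl⟩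
  have h₁ := (hχ.hasFiniteExt h).finite 1 d
  have h₂ : Module.Finite (𝒜 0)ᵐᵒᵖ (ExtMod (leftMulQuot 𝒜 1) ((L.trunc d).shift d) 0) := by
    have : Mono (shiftMap (L.truncι d) d) :=
      mono_of_injective fun i => truncι_injective L d (i + d)
    exact Module.Finite.of_injective _
      (extMap_injective_of_mono (leftMulQuot 𝒜 1) (shiftMap (L.truncι d) d))
  have h₃ : Module.Finite (𝒜 0)ᵐᵒᵖ
      (ExtMod (leftMulQuot 𝒜 1) ((coker (truncSucc L d)).shift d) 0) :=
    finite_ext₃ (leftMulQuot 𝒜 1) (hS.shift d).shortExact 0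
  obtain ⟨T, hT⟩ := h₃.fg_top
  let F := extQuotToSelf ((coker (truncSucc L d)).shift d)
  let G : Set (Σ i, (coker (truncSucc L d)).deg i) := (fun t => ⟨0 + d, evalOne _ (F t)⟩) '' T
  refine isFG_iff.2 ⟨G, T.finite_toSet.image _, fun j => (AddSubgroup.eq_top_iff' _).2 fun x => ?_⟩
  by_cases hj : j = 0 + d
  · subst hj
    obtain ⟨y, rfl⟩ := exists_evalOne_extQuotToSelf (M := (coker (truncSucc L d)).shift d) x
      fun n hn a => by
        have := hQ (0 + n + d) (by omega)
        exact Subsingleton.elim (α := (coker (truncSucc L d)).deg (0 + n + d)) _ _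
    have hy : F y ∈ Submodule.span (𝒜 0)ᵐᵒᵖ (F '' T) := by
      rw [← Submodule.map_span, hT]
      exact ⟨y, trivial, rfl⟩
    have h₄ := evalOne_mem_closure _ hy
    refine (AddSubgroup.closure_mono ?_) h₄
    rintro _ ⟨_, ⟨_, ⟨t, ht, rfl⟩, rfl⟩, n, hn, a, rfl⟩
    exact ⟨_, ⟨t, ht, rfl⟩, n, by dsimp only at hn ⊢; omega, a, rfl⟩
  · have := hQ j hj
    rw [Subsingleton.elim x 0]
    exact zero_mem _

theorem HasFiniteExt.isCofinite_tors [IsNoetherianRing Rᵐᵒᵖ] (hχ : Chi 𝒜) {M : GrMod 𝒜}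
    (hM : HasFiniteExt 𝒜 M) : IsCofinite M.tors := by
  have := isNoetherianRing_zero 𝒜
  obtain ⟨d₀, hd₀⟩ := hM.exists_tors_eq_zero
  have hb : ∀ i, d₀ ≤ i → Subsingleton (M.tors.deg i) := fun i hi =>
    subsingleton_of_forall_eq 0 fun x => Subtype.ext (hd₀ i hi x.1 x.2)
  have hfin : ∀ d, Module.Finite (𝒜 0)ᵐᵒᵖ (ExtMod (leftMulQuot 𝒜 1) (M.tors.shift d) 0) := by
    intro d
    have := hM.finite 0 d
    have : Mono (shiftMap M.torsι d) := mono_of_injective fun i => torsι_injective M (i + d)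
    exact Module.Finite.of_injective _
      (extMap_injective_of_mono (leftMulQuot 𝒜 1) (shiftMap M.torsι d))
  have htop : ∀ d, d₀ ≤ d → (M.tors.trunc d).IsFG := fun d hd =>
    isFG_of_subsingleton fun i => subsingleton_of_forall_eq 0 fun x => Subtype.ext (by
      rcases lt_or_ge i d with h | h
      · exact x.2 h
      · have := hb i (by omega)
        exact Subsingleton.elim _ _)
  refine ⟨⟨d₀, hb⟩, fun d => ?_⟩
  -- Descending induction on the truncation degree, starting at `d₀` where the truncation is zero.
  have key : ∀ n : ℕ, (M.tors.trunc (d₀ - n)).IsFG := by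
    intro n
    induction n with
    | zero => exact htop _ (by simp)
    | succ n ih =>
      refine isFG_trunc_of_succ hχ _ (hfin _) ?_
      rwa [show d₀ - ((n + 1 : ℕ) : ℤ) + 1 = d₀ - n by push_cast; ring]
  rcases le_total d₀ d with h | h
  · exact htop d h
  · have := key (d₀ - d).toNat
    rwa [show d₀ - ((d₀ - d).toNat : ℤ) = d by omega] at this

/-- After shifting by `d`, the quotient $L/L_{\ge d}$ lies in negative degrees and receives no Ext
from $R/R_{\ge 1}$. Only the finitely generated $L_{\ge d}$ matters, and $\chi$ applies to it. For
large `d` all of `L.shift d` lies in negative degrees. -/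
theorem IsCofinite.hasFiniteExt [IsNoetherianRing Rᵐᵒᵖ] (hχ : Chi 𝒜) {L : GrMod 𝒜}
    (hL : IsCofinite L) : HasFiniteExt 𝒜 L where
  finite j d := by
    have := isNoetherianRing_zero 𝒜
    have hS := isSES_of_injective (truncι_injective L d)
    have := (hχ.hasFiniteExt (hL.isFG d)).finite j d
    have : Subsingleton (ExtMod (leftMulQuot 𝒜 1) ((coker (L.truncι d)).shift d) j) :=
      ext_subsingleton_of_neg _ subsingleton_quot_deg j _ fun i hi =>
        subsingleton_of_forall_eq 0 fun x => by
          obtain ⟨x, rfl⟩ := hS.surj (i + d) x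
          exact (hS.exact (i + d) x).2 ⟨⟨x, fun h => absurd h (by omega)⟩, rfl⟩
    exact finite_ext₂ (leftMulQuot 𝒜 1) (hS.shift d).shortExact j
  vanish j := by
    obtain ⟨d₀, hd₀⟩ := hL.bounded
    exact ⟨d₀, fun d hd => ext_subsingleton_of_neg _ subsingleton_quot_deg j _
      fun i hi => hd₀ (i + d) (by omega)⟩

theorem HasFiniteExt.modTors [IsNoetherianRing Rᵐᵒᵖ] (hχ : Chi 𝒜) {M : GrMod 𝒜}
    (hM : HasFiniteExt 𝒜 M) : HasFiniteExt 𝒜 M.modTors :=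
  HasFiniteExt.quotient M.isSES_tors ((hM.isCofinite_tors hχ).hasFiniteExt hχ) hM

end NCProj

/-! ### Homogeneous components, and passage from $\mathrm{Gr}(R)$ to $\mathrm{QGr}(R)$. -/

namespace NCProj

open GrMod

variable {k : Type w} {R : Type u} [CommRing k] [Ring R] [Algebra k R]
  {𝒜 : ℕ → Submodule k R} [GradedAlgebra 𝒜] [IsNoetherianRing Rᵐᵒᵖ]

/-! ### Finite generation of the homogeneous components -/

variable (𝒜) in
-- The right ideal generated by $R_n$ has finitely many generators taken from $R_n$; in degree `n`
-- only the degree `0` parts of the coefficients contribute.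
theorem exists_finset_generating_component (n : ℕ) : ∃ B : Finset (𝒜 n), ∀ a : 𝒜 n,
    ∃ c : 𝒜 n → 𝒜 0, (a : R) = ∑ b ∈ B, b * (c b : R) := by
  classical
  let S : Set Rᵐᵒᵖ := {z | z.unop ∈ 𝒜 n}
  obtain ⟨T, hTS, hT⟩ := (Submodule.fg_span_iff_fg_span_finset_subset S).1
    (IsNoetherian.noetherian (Submodule.span Rᵐᵒᵖ S))
  refine ⟨T.attach.image fun z => ⟨z.1.unop, hTS z.2⟩, fun a => ?_⟩
  have ha : MulOpposite.op (a : R) ∈ Submodule.span Rᵐᵒᵖ (T : Set Rᵐᵒᵖ) := by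
    rw [← hT]
    exact Submodule.subset_span a.2
  obtain ⟨e, -, he⟩ := Submodule.mem_span_finset.1 ha
  have h2 : (a : R) = ∑ z ∈ T, z.unop * (e z).unop := by
    have := congrArg MulOpposite.unop he
    simpa using this.symm
  refine ⟨fun b => decompose 𝒜 (e (MulOpposite.op (b : R))).unop 0, ?_⟩
  rw [Finset.sum_image (by
    intro x _ y _ h
    exact Subtype.ext (MulOpposite.unop_injective (congrArg Subtype.val h))),
    Finset.sum_attach T (fun z => z.unop *
      (decompose 𝒜 (e (MulOpposite.op z.unop)).unop 0 : R))]
  calc (a : R) = (decompose 𝒜 (a : R) n : R) := (decompose_of_mem_same 𝒜 a.2).symm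
    _ = ∑ z ∈ T, (decompose 𝒜 (z.unop * (e z).unop) n : R) := by
      rw [h2, decompose_sum, DirectSum.sum_apply, AddSubmonoidClass.coe_finsetSum]
    _ = _ := Finset.sum_congr rfl fun z hz =>
      coe_decompose_mul_add_of_left_mem 𝒜 (j := 0) (hTS hz)

theorem finite_hom_self_of_isFG {M : GrMod 𝒜} (hM : M.IsFG) (d : ℤ) :
    Module.Finite (𝒜 0)ᵐᵒᵖ (ExtMod (leftMul 𝒜) (M.shift d) 0) := by
  obtain ⟨G, hG, hGt⟩ := isFG_iff.1 hM
  choose B hB using exists_finset_generating_component 𝒜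
  -- Each generator `p` of `M` reaches degree `d` through a single $R_n$, $n = d - \deg p$, which is
  -- finitely generated over $R_0$.
  let T : Set (M.deg (0 + d)) := ⋃ p ∈ G,
    {y | ∃ (n : ℕ) (h : p.1 + n = 0 + d), ∃ b ∈ B n, M.act n h p.2 b = y}
  have hT : T.Finite := by
    refine hG.biUnion fun p _ => ?_
    by_cases hp : ∃ n : ℕ, p.1 + n = 0 + d
    · obtain ⟨n, hn⟩ := hp
      refine ((B n).finite_toSet.image (fun b => M.act n hn p.2 b)).subset ?_
      rintro _ ⟨m, hm, b, hb, rfl⟩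
      obtain rfl : m = n := by omega
      exact ⟨b, hb, rfl⟩
    · refine Set.finite_empty.subset ?_
      rintro _ ⟨m, hm, -⟩
      exact hp ⟨m, hm⟩
  let P : Submodule (𝒜 0)ᵐᵒᵖ (ExtMod (leftMul 𝒜) (M.shift d) 0) :=
    Submodule.span _ ((fun y => Ext.mk₀ (ofElem (M := M.shift d) y)) '' T)
  have hP : ∀ y : M.deg (0 + d), y ∈ P.toAddSubgroup.map (evalOne (M.shift d)) := by
    intro y
    have hy : y ∈ M.gen G (0 + d) := by rw [hGt]; trivial
    refine (AddSubgroup.closure_le (P.toAddSubgroup.map (evalOne (M.shift d)))).2 ?_ hy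
    rintro _ ⟨p, hp, n, hn, a, rfl⟩
    obtain ⟨c, hc⟩ := hB n a
    have ha : a = ∑ b ∈ B n, ⟨b * (c b : R), SetLike.GradedMul.mul_mem b.2 (c b).2⟩ := by
      refine Subtype.ext ?_
      rw [AddSubmonoidClass.coe_finsetSum]
      exact hc
    rw [ha, map_sum]
    refine sum_mem fun b hb => ?_
    refine ⟨MulOpposite.op (c b) • (show ExtMod (leftMul 𝒜) (M.shift d) 0 from
      Ext.mk₀ (ofElem (M := M.shift d) (M.act n hn p.2 b))),
      P.smul_mem _ (Submodule.subset_span ⟨_, Set.mem_biUnion hp ⟨n, hn, b, hb, rfl⟩, rfl⟩), ?_⟩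
    rw [evalOne_smul]
    refine (congrArg (fun y => (M.shift d).act 0 _ y (c b))
      ((evalOne_mk₀ _).trans (ofElem_one _))).trans ?_
    exact M.act_mul _ _ _ _ _ _ _
  refine ⟨Submodule.fg_def.2 ⟨_, hT.image _, (Submodule.eq_top_iff'.2 fun x => ?_ : P = ⊤)⟩⟩
  obtain ⟨z, hz, hzx⟩ := hP (evalOne (M.shift d) x)
  rwa [← evalOne_injective _ hzx]

/-- A morphism $R \to L[d]$ is an element of $L_d$, so it already lands in the finitely generated
$L_{\ge d}$. -/
theorem IsCofinite.finite_hom_self {L : GrMod 𝒜} (hL : IsCofinite L) (d : ℤ) :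
    Module.Finite (𝒜 0)ᵐᵒᵖ (ExtMod (leftMul 𝒜) (L.shift d) 0) := by
  have := finite_hom_self_of_isFG (hL.isFG d) d
  refine Module.Finite.of_surjective (extMap (leftMul 𝒜) (shiftMap (L.truncι d) d) 0) fun x => ?_
  obtain ⟨f, rfl⟩ := (Ext.mk₀_bijective _ _).2 x
  let y : ((L.trunc d).shift d).deg 0 := ⟨f.app 0 selfOne, fun h => absurd h (by omega)⟩
  refine ⟨Ext.mk₀ (ofElem y), (Ext.mk₀_comp_mk₀ _ _).trans (congrArg _ (self_hom_ext ?_))⟩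
  rw [comp_app, ofElem_one]
  rfl

/-! ### The quotient functor -/

instance : PreservesFiniteLimits (π 𝒜) :=
  ObjectProperty.SerreClassLocalization.preservesFiniteLimits (π 𝒜) (tor 𝒜)

instance : PreservesFiniteColimits (π 𝒜) :=
  ObjectProperty.SerreClassLocalization.preservesFiniteColimits (π 𝒜) (tor 𝒜)

theorem GrMod.IsSES.isIso_map_left {A B C : GrMod 𝒜} {f : A ⟶ B} {g : B ⟶ C} (h : IsSES f g)
    (hC : C.IsTorsion) : IsIso ((π 𝒜).map f) := by
  have := mono_of_injective h.inj
  rw [ObjectProperty.SerreClassLocalization.isIso_map_iff (π 𝒜) (tor 𝒜),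
    ObjectProperty.isoModSerre_iff_of_mono]
  exact ((tor 𝒜).prop_iff_of_iso (IsColimit.coconePointUniqueUpToIso (cokernelIsCokernel f)
    h.shortExact.gIsCokernel)).2 hC

theorem GrMod.IsSES.isIso_map_right {A B C : GrMod 𝒜} {f : A ⟶ B} {g : B ⟶ C} (h : IsSES f g)
    (hA : A.IsTorsion) : IsIso ((π 𝒜).map g) := by
  have := epi_of_surjective h.surj
  rw [ObjectProperty.SerreClassLocalization.isIso_map_iff (π 𝒜) (tor 𝒜),
    ObjectProperty.isoModSerre_iff_of_epi]
  exact ((tor 𝒜).prop_iff_of_iso (IsLimit.conePointUniqueUpToIso (kernelIsKernel g)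
    h.shortExact.fIsKernel)).2 hA

theorem isTors_of_map_eq_zero {A B : GrMod 𝒜} {f : A ⟶ B} (h : (π 𝒜).map f = 0) (i : ℤ)
    (x : A.deg i) : B.IsTors (f.app i x) := by
  have h := (ObjectProperty.SerreClassLocalization.map_eq_zero_iff (π 𝒜) (tor 𝒜) f).1 h
  have hx := IsTors.map (Abelian.image.ι f) (h i ((Abelian.factorThruImage f).app i x))
  rwa [← comp_app, Abelian.image.fac] at hx

theorem map_π_injective {A I : GrMod 𝒜} (hI : IsTorsionFree 𝒜 I) {f g : A ⟶ I}
    (h : (π 𝒜).map f = (π 𝒜).map g) : f = g := by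
  rw [← sub_eq_zero]
  ext i x
  exact hI _ _ (isTors_of_map_eq_zero (by rw [Functor.map_sub, h, sub_self]) i x)

/-- Represent `φ` by a roof whose backward arrow starts at `I`. Its kernel is torsion inside a
torsion-free module, so it is a monomorphism, and a retraction of it exists because `I` is
injective. -/
theorem map_π_surjective {A I : GrMod 𝒜} (hI : IsTorsionFree 𝒜 I) [Injective I]
    (φ : (π 𝒜).obj A ⟶ (π 𝒜).obj I) : ∃ f, (π 𝒜).map f = φ := by
  obtain ⟨z, rfl⟩ := Localization.exists_leftFraction (π 𝒜) (tor 𝒜).isoModSerre φ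
  have : Mono z.s := Preadditive.mono_of_kernel_zero (hom_eq_zero_of_isTorsion z.hs.1 hI _)
  obtain ⟨r, hr⟩ := Injective.factors (𝟙 I) z.s
  refine ⟨z.f ≫ r, ?_⟩
  rw [Functor.map_comp, ← z.map_comp_map_s (π 𝒜) (Localization.inverts _ _), Category.assoc,
    ← Functor.map_comp, hr, CategoryTheory.Functor.map_id, Category.comp_id]

/-- A monomorphism of $\mathrm{QGr}(R)$ is isomorphic to the image of one in $\mathrm{Gr}(R)$, where
the extension problem is solved after lifting the given map by `map_π_surjective`. -/
theorem injective_obj_π {I : GrMod 𝒜} (hI : IsTorsionFree 𝒜 I) [Injective I] :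
    Injective ((π 𝒜).obj I) where
  factors {Y Z} g m hm := by
    obtain ⟨A, B, f, _, ⟨e⟩⟩ :=
      (ObjectProperty.SerreClassLocalization.mono_iff (π 𝒜) (tor 𝒜) m).1 hm
    obtain ⟨h, hh⟩ := map_π_surjective hI (e.hom.left ≫ g)
    obtain ⟨l, rfl⟩ := Injective.factors h f
    refine ⟨e.inv.right ≫ (π 𝒜).map l, ?_⟩
    have h1 : m ≫ e.inv.right = e.inv.left ≫ (π 𝒜).map f := e.inv.w.symm
    rw [← Category.assoc, h1, Category.assoc, ← Functor.map_comp, hh, ← Category.assoc,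
      ← Arrow.comp_left, e.inv_hom_id, Arrow.id_left]
    exact Category.id_comp g

end NCProj

namespace NCProj

open GrMod

variable {k : Type w} {R : Type u} [CommRing k] [Ring R] [Algebra k R]
  {𝒜 : ℕ → Submodule k R} [GradedAlgebra 𝒜] [IsNoetherianRing Rᵐᵒᵖ]

/-! ### Comparison of `Hom(R, M)` and `H^0(π M)` -/

/-- The map `Hom(R, M) → Hom(ℛ, π M)`. -/
noncomputable def homToH (M : GrMod 𝒜) :
    ExtMod (leftMul 𝒜) M 0 →ₗ[(𝒜 0)ᵐᵒᵖ] ExtMod (leftMulQ 𝒜) ((π 𝒜).obj M) 0 where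
  toFun x := Ext.mk₀ ((π 𝒜).map (Ext.addEquiv₀ (show Ext (self 𝒜) M 0 from x)))
  map_add' x y := by
    refine (congrArg (fun f => Ext.mk₀ ((π 𝒜).map f)) (map_add Ext.addEquiv₀
      (show Ext (self 𝒜) M 0 from x) y)).trans ?_
    rw [Functor.map_add, Ext.mk₀_add]
    rfl
  map_smul' s x := by
    obtain ⟨f, rfl⟩ := (Ext.mk₀_bijective _ _).2 x
    have h : s • (show ExtMod (leftMul 𝒜) M 0 from Ext.mk₀ f) = Ext.mk₀ (leftMul 𝒜 s.unop ≫ f) :=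
      Ext.mk₀_comp_mk₀ _ _
    refine (congrArg (fun x => Ext.mk₀ ((π 𝒜).map (Ext.addEquiv₀
      (show Ext (self 𝒜) M 0 from x)))) h).trans ?_
    have e : ∀ g : self 𝒜 ⟶ M, Ext.addEquiv₀ (Ext.mk₀ g) = g := fun g =>
      Ext.addEquiv₀.apply_symm_apply g
    dsimp only
    rw [e, e, Functor.map_comp]
    exact (Ext.mk₀_comp_mk₀ _ _).symm

theorem homToH_mk₀ {M : GrMod 𝒜} (f : self 𝒜 ⟶ M) :
    homToH M (Ext.mk₀ f) = Ext.mk₀ ((π 𝒜).map f) :=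
  congrArg (fun g => Ext.mk₀ ((π 𝒜).map g)) (Ext.addEquiv₀.apply_symm_apply f)

theorem homToH_bijective {I : GrMod 𝒜} (hI : IsTorsionFree 𝒜 I) [Injective I] :
    Function.Bijective (homToH I) := by
  constructor
  · intro x y h
    obtain ⟨f, rfl⟩ := (Ext.mk₀_bijective _ _).2 x
    obtain ⟨g, rfl⟩ := (Ext.mk₀_bijective _ _).2 y
    have h := (homToH_mk₀ f).symm.trans (h.trans (homToH_mk₀ g))
    rw [map_π_injective hI ((Ext.mk₀_bijective _ _).1 h)]
  · intro x
    obtain ⟨φ, rfl⟩ := (Ext.mk₀_bijective _ _).2 x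
    obtain ⟨f, rfl⟩ := map_π_surjective hI φ
    exact ⟨Ext.mk₀ f, homToH_mk₀ f⟩

/-- `M / τM` embeds in a torsion-free injective module `I`; the torsion of the quotient controls
the difference between `Hom(R, M)` and `H^0(π M)`. -/
theorem exists_controlling_map {M A I N : GrMod 𝒜} {q : M ⟶ A} {f : A ⟶ I} {p : I ⟶ N}
    (hq : ∀ i, Function.Surjective (q.app i)) [IsIso ((π 𝒜).map q)] (h : IsSES f p)
    (hI : IsTorsionFree 𝒜 I) [Injective I] :
    ∃ Θ : ExtMod (leftMulQ 𝒜) ((π 𝒜).obj M) 0 →ₗ[(𝒜 0)ᵐᵒᵖ] ExtMod (leftMul 𝒜) N 0,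
      LinearMap.ker Θ ≤ LinearMap.range (homToH M) ∧
      -- Allowing any `L` that contains the torsion of `N`, instead of `N.tors`, makes this
      -- applicable to a shift of a torsion submodule.
      ∀ x, ∀ (L : GrMod 𝒜) (i : L ⟶ N), (∀ j y, N.IsTors y → ∃ z, i.app j z = y) →
        (∀ j, Function.Injective (i.app j)) → Θ x ∈ LinearMap.range (extMap (leftMul 𝒜) i 0) := by
  let e := LinearEquiv.ofBijective (homToH I) (homToH_bijective hI)
  -- Send `φ` to `I`, lift it to `g : R ⟶ I`, and project to `N`. If the result is zero, `g` factors
  -- through `A` and then lifts to `M` by projectivity of `R`. In general `g ≫ p` dies under `π`, so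
  -- it has torsion values.
  let Θ := (extMap (leftMul 𝒜) p 0).comp (e.symm.toLinearMap.comp
    (extMap (leftMulQ 𝒜) ((π 𝒜).map (q ≫ f)) 0))
  have hΘ : ∀ φ : (π 𝒜).obj (self 𝒜) ⟶ (π 𝒜).obj M, ∃ g : self 𝒜 ⟶ I,
      φ ≫ (π 𝒜).map (q ≫ f) = (π 𝒜).map g ∧ Θ (Ext.mk₀ φ) = Ext.mk₀ (g ≫ p) := by
    intro φ
    obtain ⟨g, hg⟩ := map_π_surjective hI (φ ≫ (π 𝒜).map (q ≫ f))
    refine ⟨g, hg.symm, ?_⟩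
    have h1 : e.symm (extMap (leftMulQ 𝒜) ((π 𝒜).map (q ≫ f)) 0 (Ext.mk₀ φ)) = Ext.mk₀ g := by
      refine (LinearEquiv.symm_apply_eq e).2 ?_
      refine (Ext.mk₀_comp_mk₀ _ _).trans ?_
      rw [← hg]
      exact (homToH_mk₀ g).symm
    refine (congrArg (extMap (leftMul 𝒜) p 0) h1).trans ?_
    exact Ext.mk₀_comp_mk₀ _ _
  have := mono_of_injective h.inj
  refine ⟨Θ, fun x hx => ?_, fun x L i hi hinj => ?_⟩
  · obtain ⟨φ, rfl⟩ := (Ext.mk₀_bijective _ _).2 x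
    obtain ⟨g, hg, hg'⟩ := hΘ φ
    have h0 : g ≫ p = 0 := (Ext.mk₀_eq_zero_iff _).1 (hg'.symm.trans hx)
    obtain ⟨r, rfl⟩ := h.exists_lift g h0
    obtain ⟨l, rfl⟩ := exists_self_lift q hq r
    refine ⟨Ext.mk₀ l, (homToH_mk₀ l).trans (congrArg _ ?_)⟩
    rw [← cancel_mono ((π 𝒜).map q), ← cancel_mono ((π 𝒜).map f), Category.assoc, Category.assoc,
      ← Functor.map_comp, hg, ← Functor.map_comp, Category.assoc]
  · obtain ⟨φ, rfl⟩ := (Ext.mk₀_bijective _ _).2 x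
    obtain ⟨g, hg, hg'⟩ := hΘ φ
    have h0 : (π 𝒜).map (g ≫ p) = 0 := by
      rw [Functor.map_comp, ← hg, Category.assoc, ← Functor.map_comp, Category.assoc,
        h.comp_eq_zero, comp_zero, Functor.map_zero, comp_zero]
    obtain ⟨z, hz⟩ := hi 0 _ (isTors_of_map_eq_zero h0 0 selfOne)
    have hl : ofElem z ≫ i = g ≫ p := self_hom_ext (by rw [comp_app, ofElem_one, hz])
    refine ⟨Ext.mk₀ (ofElem z), Eq.trans ?_ hg'.symm⟩
    rw [← hl]
    exact Ext.mk₀_comp_mk₀ _ _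

/-- A module with finite Ext groups, modulo torsion, embeds in a torsion-free injective module
with quotient having finite Ext groups. -/
theorem HasFiniteExt.exists_embedding (hχ : Chi 𝒜) {M : GrMod 𝒜} (hM : HasFiniteExt 𝒜 M) :
    ∃ (I N : GrMod 𝒜) (f : M.modTors ⟶ I) (p : I ⟶ N), IsSES f p ∧ IsTorsionFree 𝒜 I ∧
      (∀ d, Injective (I.shift d)) ∧ HasFiniteExt 𝒜 N := by
  obtain ⟨I, f, hf, hI, hId⟩ := exists_torsionFree_embedding M.modTors (isTorsionFree_modTors M)
  have hS := isSES_of_injective hf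
  exact ⟨I, _, f, _, hS, hI, hId, HasFiniteExt.cosyzygy hS (hM.modTors hχ) hI hId⟩

instance isIso_map_modTorsπ (M : GrMod 𝒜) (d : ℤ) :
    IsIso ((π 𝒜).map (shiftMap M.modTorsπ d)) :=
  (M.isSES_tors.shift d).isIso_map_right (isTorsion_shift M.isTorsion_tors d)

/-- The cokernel is a quotient of the range of `Θ`, which lies in the image of $\mathrm{Hom}(R,
(\tau N)[d]) = (\tau N)_d$; and $\tau N$ is cofinite. -/
theorem HasFiniteExt.homToH_coker (hχ : Chi 𝒜) {M : GrMod 𝒜} (hM : HasFiniteExt 𝒜 M) :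
    (∀ d, Module.Finite (𝒜 0)ᵐᵒᵖ
      (ExtMod (leftMulQ 𝒜) ((π 𝒜).obj (M.shift d)) 0 ⧸ LinearMap.range (homToH (M.shift d)))) ∧
    ∃ d₀ : ℤ, ∀ d, d₀ ≤ d → Function.Surjective (homToH (M.shift d)) := by
  have := isNoetherianRing_zero 𝒜
  obtain ⟨I, N, f, p, hS, hI, hId, hN⟩ := hM.exists_embedding hχ
  have hL := hN.isCofinite_tors hχ
  have key : ∀ d, ∃ Θ : ExtMod (leftMulQ 𝒜) ((π 𝒜).obj (M.shift d)) 0 →ₗ[(𝒜 0)ᵐᵒᵖ]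
      ExtMod (leftMul 𝒜) (N.shift d) 0, LinearMap.ker Θ ≤ LinearMap.range (homToH (M.shift d)) ∧
        LinearMap.range Θ ≤ LinearMap.range (extMap (leftMul 𝒜) (shiftMap N.torsι d) 0) := by
    intro d
    have := hId d
    obtain ⟨Θ, h1, h2⟩ := exists_controlling_map (q := shiftMap M.modTorsπ d)
      (fun i => M.isSES_tors.surj (i + d)) (hS.shift d) (hI.shift d)
    refine ⟨Θ, h1, ?_⟩
    rintro _ ⟨x, rfl⟩
    exact h2 x _ (shiftMap N.torsι d)
      (fun j y hy => ⟨⟨y, (isTors_shift_iff y).1 hy⟩, rfl⟩)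
      (fun j => torsι_injective N (j + d))
  constructor
  · intro d
    obtain ⟨Θ, h1, h2⟩ := key d
    have := hL.finite_hom_self d
    have : IsNoetherian (𝒜 0)ᵐᵒᵖ (LinearMap.range Θ) := isNoetherian_of_le h2
    have := Module.Finite.equiv Θ.quotKerEquivRange.symm
    exact Module.Finite.of_surjective _ (Submodule.factor_surjective h1)
  · obtain ⟨d₀, hd₀⟩ := hL.bounded
    refine ⟨d₀, fun d hd x => ?_⟩
    obtain ⟨Θ, h1, h2⟩ := key d
    have hx : Θ x = 0 := by
      obtain ⟨y, hy⟩ := h2 ⟨x, rfl⟩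
      have := hd₀ (0 + d) (by omega)
      have hy0 : y = 0 := evalOne_injective _ (Subsingleton.elim (α := N.tors.deg (0 + d)) _ _)
      rw [← hy, hy0, map_zero]
    exact h1 hx

/-! ### Higher cohomology -/

/-- Induction through cosyzygies. The base case uses the cokernel of `homToH`, not all of $H^0$,
because the cosyzygy `N` need not be finitely generated. -/
theorem HasFiniteExt.cohomology (hχ : Chi 𝒜) (j : ℕ) : ∀ {M : GrMod 𝒜}, HasFiniteExt 𝒜 M →
    (∀ d, Module.Finite (𝒜 0)ᵐᵒᵖ (ExtMod (leftMulQ 𝒜) ((π 𝒜).obj (M.shift d)) (j + 1))) ∧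
    ∃ d₀ : ℤ, ∀ d, d₀ ≤ d →
      Subsingleton (ExtMod (leftMulQ 𝒜) ((π 𝒜).obj (M.shift d)) (j + 1)) := by
  have step : ∀ {M : GrMod 𝒜}, HasFiniteExt 𝒜 M → ∃ N : GrMod 𝒜, HasFiniteExt 𝒜 N ∧
      ∀ d j, ∃ δ : ExtMod (leftMulQ 𝒜) ((π 𝒜).obj (N.shift d)) j →ₗ[(𝒜 0)ᵐᵒᵖ]
        ExtMod (leftMulQ 𝒜) ((π 𝒜).obj (M.shift d)) (j + 1), Function.Surjective δ ∧
        (∀ hj : j = 0, ∀ x, δ (hj ▸ homToH (N.shift d) x) = 0) := by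
    intro M hM
    obtain ⟨I, N, f, p, hS, hI, hId, hN⟩ := hM.exists_embedding hχ
    refine ⟨N, hN, fun d j => ?_⟩
    have := hId d
    have hT := (hS.shift d).shortExact.map_of_exact (π 𝒜)
    have hinj : Injective ((ShortComplex.mk _ _ (hS.shift d).comp_eq_zero).map (π 𝒜)).X₂ :=
      injective_obj_π (hI.shift d)
    -- `π` does not distinguish `M` from `M.modTors`, so the connecting map may be regarded as
    -- ending in the cohomology of `M`.
    let e := extIso (leftMulQ 𝒜) (asIso ((π 𝒜).map (shiftMap M.modTorsπ d))) (j + 1)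
    refine ⟨e.symm.toLinearMap.comp (extPost (leftMulQ 𝒜) hT.extClass rfl),
      e.symm.surjective.comp fun x => ?_, ?_⟩
    · exact Ext.covariant_sequence_exact₁ _ hT x (Ext.eq_zero_of_injective _) rfl
    · rintro rfl x
      refine (congrArg e.symm ?_).trans (map_zero _)
      obtain ⟨g, rfl⟩ := (Ext.mk₀_bijective _ _).2 x
      -- A morphism $R \to N[d]$ lifts to $I[d]$ by projectivity of `R`, so the connecting map kills
      -- its image under `π`.
      obtain ⟨l, rfl⟩ := exists_self_lift (shiftMap p d) (fun i => hS.surj (i + d)) g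
      refine (congrArg (fun y => Ext.comp y hT.extClass rfl) ((homToH_mk₀ _).trans
        (congrArg Ext.mk₀ (Functor.map_comp (π 𝒜) l (shiftMap p d))))).trans ?_
      exact mk₀_comp_extClass_eq_zero hT ((π 𝒜).map l)
  induction j with
  | zero =>
    intro M hM
    obtain ⟨N, hN, h⟩ := step hM
    obtain ⟨h₁, d₀, h₂⟩ := hN.homToH_coker hχ
    refine ⟨fun d => ?_, d₀, fun d hd => ?_⟩
    · obtain ⟨δ, hδ, hδ0⟩ := h d 0
      have := h₁ d
      refine Module.Finite.of_surjective ((LinearMap.range (homToH (N.shift d))).liftQ δ ?_) ?_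
      · rintro _ ⟨x, rfl⟩
        exact hδ0 rfl x
      · intro x
        obtain ⟨y, rfl⟩ := hδ x
        exact ⟨Submodule.Quotient.mk y, rfl⟩
    · obtain ⟨δ, hδ, hδ0⟩ := h d 0
      refine subsingleton_of_forall_eq 0 fun x => ?_
      obtain ⟨y, rfl⟩ := hδ x
      obtain ⟨z, rfl⟩ := h₂ d hd y
      exact hδ0 rfl z
  | succ j ih =>
    intro M hM
    obtain ⟨N, hN, h⟩ := step hM
    obtain ⟨h₁, d₀, h₂⟩ := ih hN
    refine ⟨fun d => ?_, d₀, fun d hd => ?_⟩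
    · obtain ⟨δ, hδ, -⟩ := h d (j + 1)
      have := h₁ d
      exact Module.Finite.of_surjective δ hδ
    · obtain ⟨δ, hδ, -⟩ := h d (j + 1)
      have := h₂ d hd
      exact hδ.subsingleton

theorem finite_H_zero (hχ : Chi 𝒜) {M : GrMod 𝒜} (hM : M.IsFG) (d : ℤ) :
    Module.Finite (𝒜 0)ᵐᵒᵖ (ExtMod (leftMulQ 𝒜) ((π 𝒜).obj (M.shift d)) 0) := by
  have := isNoetherianRing_zero 𝒜
  have := ((hχ.hasFiniteExt hM).homToH_coker hχ).1 d
  have := finite_hom_self_of_isFG hM d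
  exact finite_of_exact (homToH (M.shift d)) (LinearMap.range (homToH (M.shift d))).mkQ
    fun x hx => (Submodule.Quotient.mk_eq_zero _).1 hx

end NCProj

namespace NCProj

open GrMod

variable {k : Type w} {R : Type u} [CommRing k] [Ring R] [Algebra k R]
  {𝒜 : ℕ → Submodule k R} [GradedAlgebra 𝒜]

/-! ### The shift by `0` -/

/-- Transport between equal degrees. -/
def GrMod.degCast (M : GrMod 𝒜) {i j : ℤ} (h : i = j) : M.deg i ≃+ M.deg j :=
  h ▸ AddEquiv.refl _

theorem GrMod.act_degCast (M : GrMod 𝒜) {i i' j j' : ℤ} (hi : i = i') (hj : j = j') (n : ℕ)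
    (h : i + n = j) (h' : i' + n = j') (x : M.deg i) (a : 𝒜 n) :
    M.degCast hj (M.act n h x a) = M.act n h' (M.degCast hi x) a := by
  subst hi hj
  rfl

/-- `M[0] ≅ M`. -/
def GrMod.shiftZeroIso (M : GrMod 𝒜) : M.shift 0 ≅ M where
  hom :=
    { app := fun i => (M.degCast (add_zero i)).toAddMonoidHom
      app_act := fun n h x a => M.act_degCast _ _ n _ h x a }
  inv :=
    { app := fun i => (M.degCast (add_zero i)).symm.toAddMonoidHom
      app_act := fun n h x a => (AddEquiv.symm_apply_eq _).2 (by
        refine Eq.trans ?_ (M.act_degCast (add_zero _) _ n _ h _ a).symm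
        exact congrArg (fun y => M.act n h y a) (AddEquiv.apply_symm_apply _ _).symm) }
  hom_inv_id := by
    ext i x
    exact AddEquiv.symm_apply_apply _ _
  inv_hom_id := by
    ext i x
    exact AddEquiv.apply_symm_apply _ _

/-! ### Noetherian objects of `QGr(R)` -/

variable [IsNoetherianRing Rᵐᵒᵖ]

/-- Write `ℱ` as `π M`. Among the subobjects coming from finitely generated submodules of `M` choose
a maximal one. Adjoining any further element does not enlarge it, so that element is torsion modulo
the submodule, and the inclusion becomes an isomorphism in $\mathrm{QGr}(R)$. -/
theorem exists_isFG_iso (ℱ : QGr 𝒜) [IsNoetherianObject ℱ] :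
    ∃ N : GrMod 𝒜, N.IsFG ∧ Nonempty ((π 𝒜).obj N ≅ ℱ) := by
  have := Localization.essSurj (π 𝒜) (tor 𝒜).isoModSerre
  let M := (π 𝒜).objPreimage ℱ
  let e : (π 𝒜).obj M ≅ ℱ := (π 𝒜).objObjPreimageIso ℱ
  let ι (G : Set (Σ i, M.deg i)) := M.subι _ (M.gen_closed G)
  have hι : ∀ G, Mono (ι G) := fun G => mono_of_injective (M.subι_injective _ (M.gen_closed G))
  let s (G : Set (Σ i, M.deg i)) : Subobject ℱ := Subobject.mk ((π 𝒜).map (ι G) ≫ e.hom)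
  obtain ⟨_, ⟨G, hG, rfl⟩, hmax⟩ := (wellFounded_gt (α := Subobject ℱ)).has_min
    (s '' {G | G.Finite}) ⟨_, ∅, Set.finite_empty, rfl⟩
  have hS := isSES_of_injective (M.subι_injective _ (M.gen_closed G))
  have htor : (coker (ι G)).IsTorsion := by
    intro i x
    obtain ⟨x, rfl⟩ := hS.surj i x
    let G' : Set (Σ i, M.deg i) := insert ⟨i, x⟩ G
    have hle : s G ≤ s G' := Subobject.mk_le_mk_of_comm ((π 𝒜).map (M.subMap (M.gen_closed G)
      (M.gen_closed G') (M.gen_mono (Set.subset_insert _ _)))) (by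
        rw [← Category.assoc, ← Functor.map_comp]
        rfl)
    have hge : s G' ≤ s G :=
      (not_lt_iff_le_imp_ge.1 (hmax (s G') ⟨G', hG.insert _, rfl⟩)) hle
    have hfac : (π 𝒜).map (ι G') = Subobject.ofMkLEMk _ _ hge ≫ (π 𝒜).map (ι G) := by
      rw [← cancel_mono e.hom, Category.assoc]
      exact (Subobject.ofMkLEMk_comp hge).symm
    have h0 : (π 𝒜).map (ι G' ≫ cokerπ (ι G)) = 0 := by
      rw [Functor.map_comp, hfac, Category.assoc, ← Functor.map_comp, comp_cokerπ, Functor.map_zero,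
        comp_zero]
    exact isTors_of_map_eq_zero h0 i ⟨x, mem_gen (Set.mem_insert _ _)⟩
  have := hS.isIso_map_left htor
  have := hG.to_subtype
  refine ⟨_, ?_, ⟨asIso ((π 𝒜).map (ι G)) ≪≫ e⟩⟩
  refine isFG_iff.2 ⟨(fun p : G => ⟨p.1.1, p.1.2, mem_gen p.2⟩) '' Set.univ,
    Set.toFinite _, fun j => (AddSubgroup.eq_top_iff' _).2 ?_⟩
  rintro ⟨x, hx⟩
  let E : Set (Σ i, (M.sub _ (M.gen_closed G)).deg i) :=
    (fun p : G => ⟨p.1.1, p.1.2, mem_gen p.2⟩) '' Set.univ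
  -- The submodule generated by `G` inside `M` is also generated by `G` when regarded as a module of
  -- its own.
  have hx' := gen_le (c := fun i => ((M.sub _ (M.gen_closed G)).gen E i).map ((ι G).app i)) (by
      rintro i j n h _ a ⟨y, hy, rfl⟩
      exact ⟨_, (M.sub _ (M.gen_closed G)).gen_closed E n h y a hy, (ι G).app_act n h y a⟩)
    (fun p hp => ⟨⟨p.2, mem_gen hp⟩, mem_gen ⟨⟨p, hp⟩, trivial, rfl⟩, rfl⟩) j hx
  obtain ⟨y, hy, hyx⟩ := hx'
  obtain rfl : y = ⟨x, hx⟩ := Subtype.ext hyx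
  exact hy

/-- `π` commutes with shifts. -/
noncomputable def qshiftObjIso (M : GrMod 𝒜) (d : ℤ) :
    (qshift 𝒜 d).obj ((π 𝒜).obj M) ≅ (π 𝒜).obj (M.shift d) :=
  (Localization.fac (shiftFunctor 𝒜 d ⋙ π 𝒜) (fun _ _ f hf =>
    Localization.inverts (π 𝒜) (tor 𝒜).isoModSerre _ (isoModSerre_shift d f hf)) (π 𝒜)).app M

end NCProj

/-- Serre's finiteness theorem for noncommutative projective schemes. -/
theorem mainTheorem3 {k : Type w} {R : Type u} [CommRing k] [Ring R] [Algebra k R]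
    (𝒜 : ℕ → Submodule k R) [GradedAlgebra 𝒜] [IsNoetherianRing Rᵐᵒᵖ]
    (hχ : NCProj.Chi 𝒜) (ℱ : NCProj.QGr 𝒜) (hℱ : IsNoetherianObject ℱ) :
    (∀ j : ℕ, Module.Finite (𝒜 0)ᵐᵒᵖ (NCProj.H 𝒜 j ℱ)) ∧
      (∀ j : ℕ, 1 ≤ j → ∃ d₀ : ℤ, ∀ d : ℤ, d₀ ≤ d →
        Subsingleton (NCProj.H 𝒜 j ((NCProj.qshift 𝒜 d).obj ℱ))) := by
  obtain ⟨N, hN, ⟨e⟩⟩ := NCProj.exists_isFG_iso ℱ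
  have hE := NCProj.Chi.hasFiniteExt hχ hN
  constructor
  · intro j
    have h : Module.Finite (𝒜 0)ᵐᵒᵖ
        (NCProj.ExtMod (NCProj.leftMulQ 𝒜) ((NCProj.π 𝒜).obj (N.shift 0)) j) := by
      cases j with
      | zero => exact NCProj.finite_H_zero hχ hN 0
      | succ j => exact (hE.cohomology hχ j).1 0
    exact Module.Finite.equiv (NCProj.extIso (NCProj.leftMulQ 𝒜)
      ((NCProj.π 𝒜).mapIso N.shiftZeroIso ≪≫ e) j)
  · rintro (_ | j) hj
    · omega
    · obtain ⟨d₀, hd₀⟩ := (hE.cohomology hχ j).2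
      refine ⟨d₀, fun d hd => ?_⟩
      have := hd₀ d hd
      exact (NCProj.extIso (NCProj.leftMulQ 𝒜)
        ((NCProj.qshift 𝒜 d).mapIso e.symm ≪≫ NCProj.qshiftObjIso N d) (j + 1)).injective.subsingleton
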